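/- Let $(M,d)$ be a complete metric space, $\mathbf m$ a Radon measure on $M$ that is finite on bounded sets, and $1<p<\infty$. Convergence in $L^0(\mathbf m)$ means convergence in measure on every measurable set of finite measure. For a Lipschitz function $f:M\to\mathbb R$ let $\operatorname{lip}f(x)=\limsup_{y\to x,\,y\neq x}\frac{|f(y)-f(x)|}{d(y,x)}$ (with value $0$ at isolated points), and let $D(\mathcal F^{\operatorname{lip}}_p)$ be the vector space of Lipschitz functions $f$ with $\operatorname{lip}f\in L^p(\mathbf m)$. *Relaxations.* A function $G\in L^p(\mathbf m)$ is an upper relaxation at $f\in L^0(\mathbf m)$ if there are $f_n\in D(\mathcal F^{\operatorname{lip}}_p)$ with $f_n\to f$ in $L^0(\mathbf m)$ and $\operatorname{lip}f_n\rightharpoonup\tilde G$ weakly in $L^p(\mathbf m)$, $\tilde G\le G$ a.e. It is a strong upper relaxation at $f$ if moreover there are $f_n\in D(\mathcal F^{\operatorname{lip}}_p)$ with $f_n\to f$ in $L^0(\mathbf m)$ such that $\operatorname{lip}h_n\to G$ strongly in $L^p(\mathbf m)$ for every choice of finite convex combinations $h_n$ of $\{f_k\}_{k\ge n}$. Let $D(\mathcal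 F_p)$ be the set of $f\in L^0(\mathbf m)$ for which $\liminf_n\int(\operatorname{lip}f_n)^p\,d\mathbf m<\infty$ for some $D(\mathcal F^{\operatorname{lip}}_p)\ni f_n\to f$ in $L^0(\mathbf m)$; for such $f$ the relaxed slope $|Df|_{*,p}\in L^p(\mathbf m)$ is the greatest $G\in L^p(\mathbf m)$ with $G\le\tilde G$ a.e. whenever $D(\mathcal F^{\operatorname{lip}}_p)\ni f_n\to f$ in $L^0(\mathbf m)$ and $\operatorname{lip}f_n\rightharpoonup\tilde G$ weakly in $L^p(\mathbf m)$. *Modules.* Let $f\mapsto g_f$ be a subadditive, absolutely homogeneous map from a vector space $D$ of functions to nonnegative functions in $L^p(\mathbf m)$. Consider the families $\{(f_i,A_i)\}_{i\in\mathbb N}$ with $f_i\in D$, $(A_i)$ a Borel partition of $M$ and $\sum_i\int_{A_i}g_{f_i}^p\,d\mathbf m<\infty$, with pointwise norm $|[(f_i,A_i)_i]|=g_{f_i}$ on $A_i$ and norm $\||\cdot|\|_{L^p}$, where $\{(f_i,A_i)\}\sim\{(h_j,B_j)\}$ if $g_{f_i-h_j}=0$ a.e. on $A_i\cap B_j$ for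 all $i,j$. The module generated by $f\mapsto g_f$ is the completion of the quotient space; it is an $L^p(\mathbf m)$-normed module: it carries a pointwise norm and a multiplication by $L^\infty(\mathbf m)$, extended by continuity from $a\cdot[(f_i,A_i)_i]=[(a_jf_i,A_i\cap B_j)_{i,j}]$ for $a=\sum_ja_j\chi_{B_j}$, and $f\in D$ has the differential $[f,M]$. The $L^p$-Lipschitz module $L^p_{\operatorname{lip}}(T^*M)$, with differential $d_{\operatorname{lip}}$, is generated by $f\mapsto\operatorname{lip}f$ on $D(\mathcal F^{\operatorname{lip}}_p)$; the $L^p$-cotangent module $L^p(T^*M)$, with differential $d_p$, is generated by $f\mapsto|Df|_{*,p}$ on $D(\mathcal F_p)$. **Theorem.** Assume that every strong upper relaxation at $0$ vanishes $\mathbf m$-a.e. Then: 1. $f\mapsto\int(\operatorname{lip}f)^p\,d\mathbf m$ is lower semicontinuous on $D(\mathcal F^{\operatorname{lip}}_p)$ with respect to convergence in $L^0(\mathbf m)$. 2. $d_{\operatorname{lip}}$ is closable from $L^0(\mathbf m)$ to $L^p_{\operatorname{lip}}(T^*M)$: if $f_n\in D(\mathcal F^{\operatorname{lip}}_p)$,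 $f_n\to0$ in $L^0(\mathbf m)$ and $d_{\operatorname{lip}}f_n\to\omega$, then $\omega=0$. 3. $L^p_{\operatorname{lip}}(T^*M)$ is a submodule of $L^p(T^*M)$: there is a unique linear isometric embedding $i:L^p_{\operatorname{lip}}(T^*M)\to L^p(T^*M)$ that commutes with multiplication by $L^\infty(\mathbf m)$, preserves the pointwise norm and satisfies $i(d_{\operatorname{lip}}f)=d_pf$ for all $f\in D(\mathcal F^{\operatorname{lip}}_p)$; its image is a closed subspace, stable under multiplication by $L^\infty(\mathbf m)$, which is itself an $L^p(\mathbf m)$-normed module (in particular it has the locality and glueing properties). 4. If $\{d_pf: f\in D(\mathcal F^{\operatorname{lip}}_p)\}$ is dense in $\{d_pf: f\in D(\mathcal F_p)\}$ with respect to the norm of $L^p(T^*M)$, then $i$ is onto, i.e. the two modules agree. -/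

import Mathlib

open MeasureTheory Filter Topology Set
open scoped ENNReal NNReal

/-! ### Uniform convexity of `L^p` on nonnegative functions -/

theorem rpow_uniform_convexity {r : ℝ} (hr : 1 < r) {ε : ℝ} (hε : 0 < ε) :
    ∃ C : ℝ, 0 ≤ C ∧ ∀ a b : ℝ, 0 ≤ a → 0 ≤ b →
      |a - b| ^ r ≤ ε * (a ^ r + b ^ r) + C * ((a ^ r + b ^ r) / 2 - ((a + b) / 2) ^ r) := by
  have hr0 : 0 < r := by linarith
  set φ : ℝ × ℝ → ℝ := fun z => (z.1 ^ r + z.2 ^ r) / 2 - ((z.1 + z.2) / 2) ^ r with hφ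
  have hφc : Continuous φ := by
    have h1 : Continuous fun x : ℝ => x ^ r := Real.continuous_rpow_const hr0.le
    exact (((h1.comp continuous_fst).add (h1.comp continuous_snd)).div_const 2).sub
      (h1.comp ((continuous_fst.add continuous_snd).div_const 2))
  have hφ0 : ∀ a b : ℝ, 0 ≤ a → 0 ≤ b → 0 ≤ φ (a, b) := by
    intro a b ha hb
    have := (strictConvexOn_rpow hr).convexOn.2 ha hb (by norm_num : (0:ℝ) ≤ 1/2)
      (by norm_num : (0:ℝ) ≤ 1/2) (by norm_num)
    simp only [smul_eq_mul] at this
    simp only [hφ]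
    have e : (a + b) / 2 = 1 / 2 * a + 1 / 2 * b := by ring
    rw [e]; linarith
  have hφpos : ∀ a b : ℝ, 0 ≤ a → 0 ≤ b → a ≠ b → 0 < φ (a, b) := by
    intro a b ha hb hab
    have := (strictConvexOn_rpow hr).2 ha hb hab (by norm_num : (0:ℝ) < 1/2)
      (by norm_num : (0:ℝ) < 1/2) (by norm_num)
    simp only [smul_eq_mul] at this
    simp only [hφ]
    have e : (a + b) / 2 = 1 / 2 * a + 1 / 2 * b := by ring
    rw [e]; linarith
  set K : Set (ℝ × ℝ) := {z | z ∈ Icc (0:ℝ) 1 ×ˢ Icc (0:ℝ) 1 ∧ max z.1 z.2 = 1 ∧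
    ε ≤ |z.1 - z.2| ^ r} with hK
  have hKc : IsCompact K := by
    refine (isCompact_Icc.prod isCompact_Icc).inter_right (t := {z : ℝ × ℝ | max z.1 z.2 = 1 ∧
      ε ≤ |z.1 - z.2| ^ r}) ?_
    have h2 : Continuous fun z : ℝ × ℝ => |z.1 - z.2| ^ r :=
      (Real.continuous_rpow_const hr0.le).comp (continuous_fst.sub continuous_snd).abs
    exact (isClosed_eq (continuous_fst.max continuous_snd) continuous_const).inter
      (isClosed_le continuous_const h2)
  obtain ⟨c, hc, hcK⟩ : ∃ c : ℝ, 0 < c ∧ ∀ z ∈ K, c ≤ φ z := by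
    rcases K.eq_empty_or_nonempty with h | h
    · exact ⟨1, one_pos, by simp [h]⟩
    · obtain ⟨z, hz, hmin⟩ := hKc.exists_isMinOn h hφc.continuousOn
      refine ⟨φ z, hφpos z.1 z.2 hz.1.1.1 hz.1.2.1 ?_, fun w hw => hmin hw⟩
      intro heq
      have := hz.2.2
      rw [heq, sub_self, abs_zero, Real.zero_rpow hr0.ne'] at this
      linarith
  refine ⟨1 / c, by positivity, fun a b ha hb => ?_⟩
  set t := max a b with ht
  have ht0 : 0 ≤ t := le_max_of_le_left ha
  have har := Real.rpow_nonneg ha r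
  have hbr := Real.rpow_nonneg hb r
  have hnn : 0 ≤ 1 / c * φ (a, b) := mul_nonneg (by positivity) (hφ0 a b ha hb)
  have hnn' : 0 ≤ ε * (a ^ r + b ^ r) := by positivity
  change _ ≤ ε * (a ^ r + b ^ r) + 1 / c * φ (a, b)
  rcases ht0.eq_or_lt with h0 | htpos
  · have ha' : a = 0 := le_antisymm (h0 ▸ le_max_left a b) ha
    have hb' : b = 0 := le_antisymm (h0 ▸ le_max_right a b) hb
    have : |a - b| ^ r = 0 := by simp [ha', hb', Real.zero_rpow hr0.ne']
    linarith
  have htr : t ^ r ≤ a ^ r + b ^ r := by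
    rcases max_choice a b with h | h <;> rw [ht, h] <;> linarith
  have htrpos : 0 < t ^ r := Real.rpow_pos_of_pos htpos r
  have hat : a / t ≤ 1 := (div_le_one htpos).2 (le_max_left a b)
  have hbt : b / t ≤ 1 := (div_le_one htpos).2 (le_max_right a b)
  have hscale : |a / t - b / t| ^ r = |a - b| ^ r / t ^ r := by
    rw [← sub_div, abs_div, abs_of_pos htpos, Real.div_rpow (abs_nonneg _) ht0]
  have hφs : φ (a / t, b / t) = φ (a, b) / t ^ r := by
    simp only [hφ]
    rw [Real.div_rpow ha ht0, Real.div_rpow hb ht0,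
      show (a / t + b / t) / 2 = ((a + b) / 2) / t by ring,
      Real.div_rpow (by positivity) ht0]
    ring
  by_cases hsep : ε ≤ |a / t - b / t| ^ r
  · have hmem : (a / t, b / t) ∈ K := by
      refine ⟨⟨⟨by positivity, hat⟩, ⟨by positivity, hbt⟩⟩, ?_, hsep⟩
      change max (a / t) (b / t) = 1
      rw [max_div_div_right ht0, ← ht, div_self htpos.ne']
    have h1 := hcK _ hmem
    rw [hφs, le_div_iff₀ htrpos] at h1
    have h2 : |a - b| ^ r ≤ t ^ r := by
      refine Real.rpow_le_rpow (abs_nonneg _) ?_ hr0.le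
      rw [abs_le]
      constructor <;> linarith [le_max_left a b, le_max_right a b]
    have h3 : t ^ r ≤ 1 / c * φ (a, b) := by
      rw [one_div, ← div_eq_inv_mul, le_div_iff₀ hc]; linarith
    linarith
  · push Not at hsep
    rw [hscale, div_lt_iff₀ htrpos] at hsep
    have : ε * t ^ r ≤ ε * (a ^ r + b ^ r) := mul_le_mul_of_nonneg_left htr hε.le
    linarith

section Lp
variable {M : Type*} [MeasurableSpace M] {m : Measure M} {p : ℝ≥0∞}

theorem Lp_norm_rpow_eq_integral (hp1 : 1 < p) (hp : p ≠ ∞) (u : Lp ℝ p m) :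
    ‖u‖ ^ p.toReal = ∫ x, |u x| ^ p.toReal ∂m := by
  have hp0 : p ≠ 0 := (zero_lt_one.trans hp1).ne'
  have hr : 0 < p.toReal := ENNReal.toReal_pos hp0 hp
  rw [Lp.norm_def, (Lp.memLp u).eLpNorm_eq_integral_rpow_norm hp0 hp,
    ENNReal.toReal_ofReal (by positivity), ← Real.rpow_mul (by positivity),
    inv_mul_cancel₀ hr.ne', Real.rpow_one]
  rfl

theorem Lp_uniform_convexity [Fact (1 ≤ p)] (hp1 : 1 < p) (hp : p ≠ ∞) {ε : ℝ} (hε : 0 < ε) :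
    ∃ C : ℝ, 0 ≤ C ∧ ∀ u v : Lp ℝ p m, 0 ≤ u → 0 ≤ v →
      ‖u - v‖ ^ p.toReal ≤ ε * (‖u‖ ^ p.toReal + ‖v‖ ^ p.toReal) +
        C * ((‖u‖ ^ p.toReal + ‖v‖ ^ p.toReal) / 2 - ‖(2⁻¹ : ℝ) • (u + v)‖ ^ p.toReal) := by
  have hp0 : p ≠ 0 := (zero_lt_one.trans hp1).ne'
  have hr : 1 < p.toReal := by
    rw [← ENNReal.toReal_one]; exact (ENNReal.toReal_lt_toReal (by simp) hp).2 hp1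
  obtain ⟨C, hC, H⟩ := rpow_uniform_convexity hr hε
  refine ⟨C, hC, fun u v hu hv => ?_⟩
  have hi : ∀ w : Lp ℝ p m, Integrable (fun x => |w x| ^ p.toReal) m :=
    fun w => (Lp.memLp w).integrable_norm_rpow hp0 hp
  simp only [Lp_norm_rpow_eq_integral hp1 hp]
  have i1 : Integrable (fun x => |u x| ^ p.toReal + |v x| ^ p.toReal) m := (hi u).add (hi v)
  have i2 : Integrable (fun x => (|u x| ^ p.toReal + |v x| ^ p.toReal) / 2) m := i1.div_const 2
  have i3 : Integrable (fun x => (|u x| ^ p.toReal + |v x| ^ p.toReal) / 2 -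
      |((2⁻¹ : ℝ) • (u + v) : Lp ℝ p m) x| ^ p.toReal) m := i2.sub (hi _)
  have i4 := i1.const_mul ε
  have i5 := i3.const_mul C
  rw [← integral_add (hi u) (hi v), ← integral_const_mul, ← integral_div,
    ← integral_sub i2 (hi _), ← integral_const_mul, ← integral_add i4 i5]
  refine integral_mono_ae (hi _) (i4.add i5) ?_
  have hu' := (Lp.coeFn_nonneg u).2 hu
  have hv' := (Lp.coeFn_nonneg v).2 hv
  filter_upwards [hu', hv', Lp.coeFn_sub u v, Lp.coeFn_smul (2⁻¹ : ℝ) (u + v),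
    Lp.coeFn_add u v] with x h1 h2 h3 h4 h5
  simp only [Pi.zero_apply] at h1 h2
  have := H (u x) (v x) h1 h2
  simp only [h3, h4, h5, Pi.sub_apply, Pi.smul_apply, Pi.add_apply, smul_eq_mul, abs_of_nonneg h1,
    abs_of_nonneg h2]
  have h6 : |2⁻¹ * (u x + v x)| = (u x + v x) / 2 := by
    rw [abs_of_nonneg (mul_nonneg (by norm_num) (add_nonneg h1 h2))]; ring
  rw [h6]
  exact this

theorem Lp_cauchySeq_of_midpoint [Fact (1 ≤ p)] (hp1 : 1 < p) (hp : p ≠ ∞) {u : ℕ → Lp ℝ p m}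
    (hu : ∀ n, 0 ≤ u n) {c : ℝ} (hc : Tendsto (fun n => ‖u n‖) atTop (𝓝 c)) {b : ℕ → ℝ}
    (hb0 : ∀ n, 0 ≤ b n) (hb : Tendsto b atTop (𝓝 c))
    (hmid : ∀ n k, n ≤ k → b n ≤ ‖(2⁻¹ : ℝ) • (u n + u k)‖) : CauchySeq u := by
  have hp0 : p ≠ 0 := (zero_lt_one.trans hp1).ne'
  have hr : 0 < p.toReal := ENNReal.toReal_pos hp0 hp
  set r := p.toReal
  have hc0 : 0 ≤ c := ge_of_tendsto' hb hb0
  have hcr : Tendsto (fun n => ‖u n‖ ^ r) atTop (𝓝 (c ^ r)) :=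
    hc.rpow_const (Or.inr hr.le)
  have hbr : Tendsto (fun n => b n ^ r) atTop (𝓝 (c ^ r)) := hb.rpow_const (Or.inr hr.le)
  rw [Metric.cauchySeq_iff']
  intro δ hδ
  have hδr : 0 < δ ^ r := Real.rpow_pos_of_pos hδ r
  set ε := δ ^ r / (4 * (c ^ r + 1)) with hεd
  have hcr0 : 0 ≤ c ^ r := Real.rpow_nonneg hc0 r
  have hε : 0 < ε := by positivity
  obtain ⟨C, hC, H⟩ := Lp_uniform_convexity (m := m) hp1 hp hε
  set η := min 1 (δ ^ r / (4 * (C + 1))) with hη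
  have hη0 : 0 < η := by positivity
  have e1 : ∀ᶠ n in atTop, ‖u n‖ ^ r < c ^ r + η := hcr.eventually_lt_const (by linarith)
  have e2 : ∀ᶠ n in atTop, c ^ r - η < b n ^ r := hbr.eventually_const_lt (by linarith)
  obtain ⟨N, hN⟩ := eventually_atTop.1 (e1.and e2)
  refine ⟨N, fun n hn => ?_⟩
  have hub := H (u n) (u N) (hu n) (hu N)
  have h1 := (hN n hn).1
  have h2 := (hN N le_rfl).1
  have h3 := (hN N le_rfl).2
  have h4 : b N ^ r ≤ ‖(2⁻¹ : ℝ) • (u n + u N)‖ ^ r := by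
    rw [add_comm]; exact Real.rpow_le_rpow (hb0 N) (hmid N n hn) hr.le
  have hη1 : η ≤ 1 := min_le_left _ _
  have hη2 : η * (4 * (C + 1)) ≤ δ ^ r := by
    rw [← le_div_iff₀ (by positivity)]; exact min_le_right _ _
  have hε2 : ε * (4 * (c ^ r + 1)) = δ ^ r := by rw [hεd]; field_simp
  have h5 : ε * (‖u n‖ ^ r + ‖u N‖ ^ r) ≤ ε * (2 * (c ^ r + 1)) :=
    mul_le_mul_of_nonneg_left (by linarith) hε.le
  have h6 : C * ((‖u n‖ ^ r + ‖u N‖ ^ r) / 2 - ‖(2⁻¹ : ℝ) • (u n + u N)‖ ^ r) ≤ C * (2 * η) :=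
    mul_le_mul_of_nonneg_left (by linarith) hC
  have h7 : ‖u n - u N‖ ^ r < δ ^ r := by nlinarith
  rw [dist_eq_norm]
  exact lt_of_not_ge fun hge => absurd (Real.rpow_le_rpow hδ.le hge hr.le) (not_le.2 h7)

theorem Lp_smul_le {u v : Lp ℝ p m} {a : ℝ} (ha : 0 ≤ a) (huv : u ≤ v) : a • u ≤ a • v := by
  rw [← Lp.coeFn_le] at huv ⊢
  filter_upwards [huv, Lp.coeFn_smul a u, Lp.coeFn_smul a v] with z h1 h2 h3
  rw [h2, h3]; exact mul_le_mul_of_nonneg_left h1 ha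

end Lp

/-! ### `L^0` convergence and weak convergence in `L^p` -/

section Conv
variable {M : Type*} [MeasurableSpace M]

/-- Convergence in `L^0(m)`: convergence in measure on every measurable set of finite measure. -/
def TendstoL0 (m : Measure M) (f : ℕ → M →ₘ[m] ℝ) (g : M →ₘ[m] ℝ) : Prop :=
  ∀ E : Set M, MeasurableSet E → m E ≠ ∞ →
    TendstoInMeasure (m.restrict E) (fun n => (f n : M → ℝ)) atTop (g : M → ℝ)

/-- Weak convergence in `L^p(m)`. -/
def WeakTendstoLp {m : Measure M} {p : ℝ≥0∞} [Fact (1 ≤ p)] (u : ℕ → Lp ℝ p m) (G : Lp ℝ p m) :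
    Prop :=
  ∀ φ : StrongDual ℝ (Lp ℝ p m), Tendsto (fun n => φ (u n)) atTop (𝓝 (φ G))

variable {m : Measure M}

theorem tendstoL0_of_ae {f : ℕ → M →ₘ[m] ℝ} {g : M →ₘ[m] ℝ}
    (h : ∀ᵐ x ∂m, Tendsto (fun n => f n x) atTop (𝓝 (g x))) : TendstoL0 m f g := by
  intro E _ hE
  have : IsFiniteMeasure (m.restrict E) := ⟨by simpa using hE.lt_top⟩
  exact tendstoInMeasure_of_tendsto_ae
    (fun n => (f n).aestronglyMeasurable.mono_measure Measure.restrict_le_self)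
    (ae_mono Measure.restrict_le_self h)

theorem TendstoL0.comp {f : ℕ → M →ₘ[m] ℝ} {g : M →ₘ[m] ℝ} (h : TendstoL0 m f g) {ns : ℕ → ℕ}
    (hns : StrictMono ns) : TendstoL0 m (fun n => f (ns n)) g :=
  fun E hE hE' => (h E hE hE').comp hns.tendsto_atTop

theorem TendstoL0.exists_subseq_ae [SigmaFinite m] {f : ℕ → M →ₘ[m] ℝ} {g : M →ₘ[m] ℝ}
    (h : TendstoL0 m f g) :
    ∃ ns : ℕ → ℕ, StrictMono ns ∧ ∀ᵐ x ∂m, Tendsto (fun n => f (ns n) x) atTop (𝓝 (g x)) := by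
  set ν := m.toFinite
  have hνm : ν ≪ m := toFinite_absolutelyContinuous m
  have hmν : m ≪ ν := absolutelyContinuous_toFinite m
  set S := spanningSets m
  have hSm : ∀ k, MeasurableSet (S k) := measurableSet_spanningSets m
  have h1 : ∀ k, TendstoInMeasure (ν.restrict (S k)) (fun n => (f n : M → ℝ)) atTop g := by
    intro k
    have : IsFiniteMeasure (m.restrict (S k)) := ⟨by simpa using measure_spanningSets_lt_top m k⟩
    have hk := h (S k) (hSm k) (measure_spanningSets_lt_top m k).ne
    have ac : ν.restrict (S k) ≪ m.restrict (S k) := hνm.restrict (S k)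
    rw [exists_seq_tendstoInMeasure_atTop_iff
      (fun n => ((f n).aestronglyMeasurable.mono_ac hνm).mono_measure Measure.restrict_le_self)]
    intro ns hns
    obtain ⟨ns', h1, h2⟩ := (hk.comp hns.tendsto_atTop).exists_seq_tendsto_ae
    exact ⟨ns', h1, ac.ae_le h2⟩
  have h2 : TendstoInMeasure ν (fun n => (f n : M → ℝ)) atTop g := by
    intro ε hε
    have hlim : Tendsto (fun k => ν (S k)ᶜ) atTop (𝓝 0) := by
      have : Tendsto (fun k => ν (S k)ᶜ) atTop (𝓝 (ν (⋂ k, (S k)ᶜ))) := by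
        refine tendsto_measure_iInter_atTop (fun k => (hSm k).compl.nullMeasurableSet) ?_
          ⟨0, measure_ne_top _ _⟩
        exact fun i j hij => compl_subset_compl.2 (monotone_spanningSets m hij)
      rwa [← compl_iUnion, iUnion_spanningSets, compl_univ, measure_empty] at this
    rw [ENNReal.tendsto_nhds_zero]
    intro δ hδ
    obtain ⟨k, hk⟩ := ((ENNReal.tendsto_nhds_zero.1 hlim) (δ / 2) (ENNReal.half_pos hδ.ne')).exists
    filter_upwards [(ENNReal.tendsto_nhds_zero.1 (h1 k ε hε)) (δ / 2)
      (ENNReal.half_pos hδ.ne')] with n hn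
    rw [Measure.restrict_apply' (hSm k)] at hn
    calc _ ≤ ν (({x | ε ≤ edist (f n x) (g x)} ∩ S k) ∪ (S k)ᶜ) := by
            refine measure_mono fun x hx => ?_
            by_cases hxk : x ∈ S k
            · exact Or.inl ⟨hx, hxk⟩
            · exact Or.inr hxk
      _ ≤ _ := measure_union_le _ _
      _ ≤ δ / 2 + δ / 2 := add_le_add hn hk
      _ = δ := ENNReal.add_halves δ
  obtain ⟨ns, hns, hae⟩ := h2.exists_seq_tendsto_ae
  exact ⟨ns, hns, hmν.ae_le hae⟩

end Conv

/-! ### `L^p`-valued functionals -/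

/-- An `L^p(m)`-valued, nonnegative, subadditive and absolutely homogeneous functional
`f ↦ g_f` on a vector space `V` of functions; `toL0` sends a function to its class in `L^0(m)`. -/
structure LpFunctional {M : Type*} [MeasurableSpace M] (m : Measure M) (p : ℝ≥0∞) [Fact (1 ≤ p)]
    (V : Type*) [AddCommGroup V] [Module ℝ V] where
  toL0 : V →ₗ[ℝ] (M →ₘ[m] ℝ)
  g : V → Lp ℝ p m
  g_nonneg : ∀ f, 0 ≤ g f
  g_add_le : ∀ f h, g (f + h) ≤ g f + g h
  g_smul : ∀ (c : ℝ) f, g (c • f) = |c| • g f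

namespace LpFunctional

section Relax
variable {M : Type*} [MeasurableSpace M] {m : Measure M} {p : ℝ≥0∞} [Fact (1 ≤ p)]
  {V : Type*} [AddCommGroup V] [Module ℝ V] (F : LpFunctional m p V)

/-- `u n → f` in `L^0(m)`, for a sequence `u` in the domain of the functional. -/
def ConvergesTo (u : ℕ → V) (f : M →ₘ[m] ℝ) : Prop :=
  TendstoL0 m (fun n => F.toL0 (u n)) f

/-- The lower semicontinuous hull of `f ↦ ∫ g_f ^ p`. -/
noncomputable def hullEnergy (f : M →ₘ[m] ℝ) : ℝ≥0∞ :=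
  ⨅ (u : ℕ → V) (_ : F.ConvergesTo u f),
    liminf (fun n => ∫⁻ x, ‖F.g (u n) x‖ₑ ^ p.toReal ∂m) atTop

/-- Upper relaxations at `f`. -/
def IsUpperRelaxation (f : M →ₘ[m] ℝ) (G : Lp ℝ p m) : Prop :=
  ∃ (u : ℕ → V) (G' : Lp ℝ p m), F.ConvergesTo u f ∧ WeakTendstoLp (fun n => F.g (u n)) G' ∧ G' ≤ G

/-- Strong upper relaxations at `f`: upper relaxations `G` for which some sequence `u n → f`
has `g_{h n} → G` strongly whenever each `h n` is a finite convex combination of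
`{u k | n ≤ k}`. -/
def IsStrongUpperRelaxation (f : M →ₘ[m] ℝ) (G : Lp ℝ p m) : Prop :=
  F.IsUpperRelaxation f G ∧ ∃ u : ℕ → V, F.ConvergesTo u f ∧
    ∀ h : ℕ → V, (∀ n, h n ∈ convexHull ℝ (u '' Ici n)) →
      Tendsto (fun n => F.g (h n)) atTop (𝓝 G)

/-- The set of all `G` lying below every weak limit of `g_{u n}`, `u n → f`. -/
def lowerSet (f : M →ₘ[m] ℝ) : Set (Lp ℝ p m) :=
  {G | ∀ (u : ℕ → V) (G' : Lp ℝ p m), F.ConvergesTo u f →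
    WeakTendstoLp (fun n => F.g (u n)) G' → G ≤ G'}

open Classical in
/-- The lower relaxation at `f`: the greatest element of `lowerSet f`
(it exists for `hullEnergy f < ∞`, see `isGreatest_lowerRelax`). -/
noncomputable def lowerRelax (f : M →ₘ[m] ℝ) : Lp ℝ p m :=
  if h : ∃ G, IsGreatest (F.lowerSet f) G then h.choose else 0

end Relax

end LpFunctional

namespace LpFunctional

section RelaxLemmas
variable {M : Type*} [MeasurableSpace M] {m : Measure M} {p : ℝ≥0∞} [Fact (1 ≤ p)]
  {V : Type*} [AddCommGroup V] [Module ℝ V] (F : LpFunctional m p V)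

theorem g_zero : F.g 0 = 0 := by
  have := F.g_smul 0 0
  simpa using this

theorem convexHull_toL0 {u : ℕ → V} {s : Set ℕ} {w : V} (hw : w ∈ convexHull ℝ (u '' s)) :
    ∀ᵐ x ∂m, F.toL0 w x ∈ convexHull ℝ ((fun k => F.toL0 (u k) x) '' s) := by
  revert w
  suffices convexHull ℝ (u '' s) ⊆
      {w | ∀ᵐ x ∂m, F.toL0 w x ∈ convexHull ℝ ((fun k => F.toL0 (u k) x) '' s)} from
    fun w hw => this hw
  refine convexHull_min ?_ ?_
  · rintro _ ⟨k, hk, rfl⟩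
    exact ae_of_all m fun x =>
      subset_convexHull ℝ _ (mem_image_of_mem (fun k => F.toL0 (u k) x) hk)
  · intro w1 h1 w2 h2 a b ha hb hab
    change ∀ᵐ x ∂m, _
    rw [map_add, map_smul, map_smul]
    filter_upwards [h1, h2, AEEqFun.coeFn_add (a • F.toL0 w1) (b • F.toL0 w2),
      AEEqFun.coeFn_smul a (F.toL0 w1), AEEqFun.coeFn_smul b (F.toL0 w2)] with x e1 e2 e3 e4 e5
    rw [e3, Pi.add_apply, e4, e5]
    exact convex_convexHull ℝ _ e1 e2 ha hb hab

/-- Convex combinations of tails of an a.e. convergent sequence converge a.e. -/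
theorem ae_tendsto_of_convexHull {u : ℕ → V} {f : M →ₘ[m] ℝ}
    (hu : ∀ᵐ x ∂m, Tendsto (fun n => F.toL0 (u n) x) atTop (𝓝 (f x))) {h : ℕ → V}
    (hh : ∀ n, h n ∈ convexHull ℝ (u '' Ici n)) :
    ∀ᵐ x ∂m, Tendsto (fun n => F.toL0 (h n) x) atTop (𝓝 (f x)) := by
  have := ae_all_iff.2 fun n => F.convexHull_toL0 (hh n)
  filter_upwards [hu, this] with x h1 h2
  rw [Metric.tendsto_atTop'] at h1
  refine Metric.tendsto_atTop'.2 fun ε hε => ?_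
  obtain ⟨N, hN⟩ := h1 ε hε
  refine ⟨N, fun n hn => ?_⟩
  have : convexHull ℝ ((fun k => F.toL0 (u k) x) '' Ici n) ⊆ Metric.ball (f x) ε := by
    refine convexHull_min ?_ (convex_ball _ _)
    rintro _ ⟨k, hk, rfl⟩
    exact hN k (lt_of_lt_of_le hn hk)
  exact this (h2 n)

theorem exists_strong_convex (hp1 : 1 < p) (hp : p ≠ ∞) {u : ℕ → V} {C : ℝ}
    (hC : ∀ n, ‖F.g (u n)‖ ≤ C) :
    ∃ (h : ℕ → V) (G : Lp ℝ p m), (∀ n, h n ∈ convexHull ℝ (u '' Ici n)) ∧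
      Tendsto (fun n => F.g (h n)) atTop (𝓝 G) := by
  set S : ℕ → Set ℝ := fun n => (fun w => ‖F.g w‖) '' convexHull ℝ (u '' Ici n) with hS
  set b : ℕ → ℝ := fun n => sInf (S n) with hb
  have hbdd : ∀ n, BddBelow (S n) := fun n => ⟨0, by rintro _ ⟨w, -, rfl⟩; positivity⟩
  have hne : ∀ n, (S n).Nonempty := fun n =>
    ⟨_, u n, subset_convexHull ℝ _ ⟨n, self_mem_Ici, rfl⟩, rfl⟩
  have hb0 : ∀ n, 0 ≤ b n := fun n =>
    le_csInf (hne n) (by rintro _ ⟨w, -, rfl⟩; positivity)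
  have hbC : ∀ n, b n ≤ C := fun n =>
    (csInf_le (hbdd n) ⟨u n, subset_convexHull ℝ _ ⟨n, self_mem_Ici, rfl⟩, rfl⟩).trans (hC n)
  have hanti : ∀ n k, n ≤ k → convexHull ℝ (u '' Ici k) ⊆ convexHull ℝ (u '' Ici n) :=
    fun n k hnk => convexHull_mono (image_mono (Ici_subset_Ici.2 hnk))
  have hmono : Monotone b := fun n k hnk =>
    csInf_le_csInf (hbdd n) (hne k) (image_mono (hanti n k hnk))
  have hlim : Tendsto b atTop (𝓝 (⨆ n, b n)) :=
    tendsto_atTop_ciSup hmono ⟨C, by rintro _ ⟨n, rfl⟩; exact hbC n⟩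
  have hex : ∀ n : ℕ, ∃ w ∈ convexHull ℝ (u '' Ici n), ‖F.g w‖ < b n + 1 / ((n : ℝ) + 1) := by
    intro n
    have hpos : (0 : ℝ) < 1 / ((n : ℝ) + 1) := by positivity
    obtain ⟨_, ⟨w, hw, rfl⟩, hlt⟩ := exists_lt_of_csInf_lt (hne n)
      (show sInf (S n) < b n + 1 / ((n : ℝ) + 1) by linarith)
    exact ⟨w, hw, hlt⟩
  choose h hh hlt using hex
  have hge : ∀ n w, w ∈ convexHull ℝ (u '' Ici n) → b n ≤ ‖F.g w‖ :=
    fun n w hw => csInf_le (hbdd n) ⟨w, hw, rfl⟩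
  have hnorm : Tendsto (fun n => ‖F.g (h n)‖) atTop (𝓝 (⨆ n, b n)) := by
    refine tendsto_of_tendsto_of_tendsto_of_le_of_le hlim
      (h := fun n : ℕ => b n + 1 / ((n : ℝ) + 1)) ?_ (fun n => hge n _ (hh n))
      (fun n => (hlt n).le)
    simpa using hlim.add tendsto_one_div_add_atTop_nhds_zero_nat
  have hcau : CauchySeq fun n => F.g (h n) := by
    refine Lp_cauchySeq_of_midpoint hp1 hp (fun n => F.g_nonneg _) hnorm hb0 hlim ?_
    intro n k hnk
    have hmem : (2⁻¹ : ℝ) • (h n + h k) ∈ convexHull ℝ (u '' Ici n) := by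
      rw [smul_add]
      exact convex_convexHull ℝ _ (hh n) (hanti n k hnk (hh k)) (by norm_num) (by norm_num)
        (by norm_num)
    refine (hge n _ hmem).trans ?_
    have h0 : 0 ≤ F.g ((2⁻¹ : ℝ) • (h n + h k)) := F.g_nonneg _
    have h1 : F.g ((2⁻¹ : ℝ) • (h n + h k)) ≤ (2⁻¹ : ℝ) • (F.g (h n) + F.g (h k)) := by
      have e2 : |(2⁻¹ : ℝ)| = 2⁻¹ := by norm_num
      rw [smul_add, smul_add]
      refine (F.g_add_le _ _).trans (le_of_eq ?_)
      rw [F.g_smul, F.g_smul, e2]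
    refine norm_le_norm_of_abs_le_abs ?_
    rw [abs_of_nonneg h0, abs_of_nonneg (h0.trans h1)]
    exact h1
  obtain ⟨G, hG⟩ := cauchySeq_tendsto_of_complete hcau
  exact ⟨h, G, hh, hG⟩

theorem lintegral_g (hp1 : 1 < p) (hp : p ≠ ∞) (f : V) :
    ∫⁻ x, ‖F.g f x‖ₑ ^ p.toReal ∂m = ‖F.g f‖ₑ ^ p.toReal := by
  have hp0 : p ≠ 0 := (zero_lt_one.trans hp1).ne'
  have hr : 0 < p.toReal := ENNReal.toReal_pos hp0 hp
  rw [Lp.enorm_def, eLpNorm_eq_lintegral_rpow_enorm_toReal hp0 hp, ← ENNReal.rpow_mul,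
    one_div_mul_cancel hr.ne', ENNReal.rpow_one]

theorem hullEnergy_lt_top_iff [SigmaFinite m] (hp1 : 1 < p) (hp : p ≠ ∞) {f : M →ₘ[m] ℝ} :
    F.hullEnergy f < ∞ ↔ ∃ (u : ℕ → V) (C : ℝ),
      (∀ᵐ x ∂m, Tendsto (fun n => F.toL0 (u n) x) atTop (𝓝 (f x))) ∧ ∀ n, ‖F.g (u n)‖ ≤ C := by
  have hp0 : p ≠ 0 := (zero_lt_one.trans hp1).ne'
  have hr : 0 < p.toReal := ENNReal.toReal_pos hp0 hp
  constructor
  · intro h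
    obtain ⟨u, hu⟩ := iInf_lt_iff.1 h
    obtain ⟨hconv, hlim⟩ := iInf_lt_iff.1 hu
    obtain ⟨c, hc1, hc2⟩ := exists_between hlim
    have hfr := frequently_lt_of_liminf_lt (by isBoundedDefault) hc1
    obtain ⟨ns, hns, hlt⟩ := extraction_of_frequently_atTop hfr
    obtain ⟨ks, hks, hae⟩ := (hconv.comp hns).exists_subseq_ae
    refine ⟨fun n => u (ns (ks n)), (c ^ (p.toReal)⁻¹).toReal, hae, fun n => ?_⟩
    have h1 := hlt (ks n)
    rw [F.lintegral_g hp1 hp] at h1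
    have h2 : ‖F.g (u (ns (ks n)))‖ₑ ≤ c ^ (p.toReal)⁻¹ := by
      rw [ENNReal.le_rpow_inv_iff hr]; exact h1.le
    rw [← toReal_enorm]
    exact ENNReal.toReal_mono (ENNReal.rpow_ne_top_of_nonneg (by positivity) hc2.ne) h2
  · rintro ⟨u, C, hae, hC⟩
    refine lt_of_le_of_lt (iInf₂_le u (tendstoL0_of_ae hae)) ?_
    have : ∀ n, ∫⁻ x, ‖F.g (u n) x‖ₑ ^ p.toReal ∂m ≤ ENNReal.ofReal C ^ p.toReal := by
      intro n
      rw [F.lintegral_g hp1 hp]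
      refine ENNReal.rpow_le_rpow ?_ hr.le
      rw [← ofReal_norm]
      exact ENNReal.ofReal_le_ofReal (hC n)
    refine lt_of_le_of_lt (liminf_le_of_frequently_le' (Frequently.of_forall this)) ?_
    exact ENNReal.rpow_lt_top_of_nonneg hr.le ENNReal.ofReal_ne_top

theorem weak_of_strong {u : ℕ → Lp ℝ p m} {G : Lp ℝ p m} (h : Tendsto u atTop (𝓝 G)) :
    WeakTendstoLp u G := fun φ => (φ.continuous.tendsto G).comp h

theorem weak_bounded {u : ℕ → Lp ℝ p m} {G : Lp ℝ p m} (h : WeakTendstoLp u G) :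
    ∃ C, ∀ n, ‖u n‖ ≤ C := by
  have := banach_steinhaus (g := fun n => NormedSpace.inclusionInDoubleDual ℝ (Lp ℝ p m) (u n))
    (fun φ => by
      obtain ⟨C, hC⟩ := (h φ).norm.bddAbove_range
      exact ⟨C, fun n => hC ⟨n, rfl⟩⟩)
  obtain ⟨C, hC⟩ := this
  refine ⟨C, fun n => ?_⟩
  have e := (NormedSpace.inclusionInDoubleDualLi ℝ (E := Lp ℝ p m)).norm_map (u n)
  rw [← e]; exact hC n

theorem weak_nonneg {u : ℕ → Lp ℝ p m} {G : Lp ℝ p m} (h : WeakTendstoLp u G)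
    (hu : ∀ n, 0 ≤ u n) : 0 ≤ G := by
  by_contra hG
  have hconv : Convex ℝ (Ici (0 : Lp ℝ p m)) := by
    intro x hx y hy a b ha hb _
    have h1 : 0 ≤ a • x := by
      rw [mem_Ici, ← Lp.coeFn_nonneg] at hx
      rw [← Lp.coeFn_nonneg]
      filter_upwards [hx, Lp.coeFn_smul a x] with z h1 h2
      rw [h2]; exact mul_nonneg ha h1
    have h2 : 0 ≤ b • y := by
      rw [mem_Ici, ← Lp.coeFn_nonneg] at hy
      rw [← Lp.coeFn_nonneg]
      filter_upwards [hy, Lp.coeFn_smul b y] with z h1 h2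
      rw [h2]; exact mul_nonneg hb h1
    exact add_nonneg h1 h2
  obtain ⟨φ, s, h1, h2⟩ := geometric_hahn_banach_closed_point hconv isClosed_Ici hG
  have := le_of_tendsto' (h φ) (fun n => (h1 (u n) (hu n)).le)
  linarith

end RelaxLemmas

end LpFunctional

namespace LpFunctional

section RelaxFunctional
variable {M : Type*} [MeasurableSpace M] {m : Measure M} {p : ℝ≥0∞} [Fact (1 ≤ p)]
  {V : Type*} [AddCommGroup V] [Module ℝ V] (F : LpFunctional m p V)

theorem Lp_norm_mono {u v : Lp ℝ p m} (hu : 0 ≤ u) (huv : u ≤ v) : ‖u‖ ≤ ‖v‖ := by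
  refine norm_le_norm_of_abs_le_abs ?_
  rwa [abs_of_nonneg hu, abs_of_nonneg (hu.trans huv)]

theorem weak_convexHull {v W : ℕ → Lp ℝ p m} {G : Lp ℝ p m} (h : WeakTendstoLp v G)
    (hW : ∀ n, W n ∈ convexHull ℝ (v '' Ici n)) : WeakTendstoLp W G := by
  intro φ
  have h1 := Metric.tendsto_atTop'.1 (h φ)
  refine Metric.tendsto_atTop'.2 fun ε hε => ?_
  obtain ⟨N, hN⟩ := h1 ε hε
  refine ⟨N, fun n hn => ?_⟩
  have : convexHull ℝ (v '' Ici n) ⊆ φ ⁻¹' Metric.ball (φ G) ε := by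
    refine convexHull_min ?_ ((convex_ball _ _).linear_preimage φ.toLinearMap)
    rintro _ ⟨k, hk, rfl⟩
    exact hN k (lt_of_lt_of_le hn hk)
  exact this (hW n)

theorem weak_le {u v : ℕ → Lp ℝ p m} {G G' : Lp ℝ p m} (hu : WeakTendstoLp u G)
    (hv : WeakTendstoLp v G') (huv : ∀ n, u n ≤ v n) : G ≤ G' := by
  have : WeakTendstoLp (fun n => v n - u n) (G' - G) := by
    intro φ; simpa using (hv φ).sub (hu φ)
  exact sub_nonneg.1 (weak_nonneg this fun n => sub_nonneg.2 (huv n))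

theorem exists_strong_upper [SigmaFinite m] (hp1 : 1 < p) (hp : p ≠ ∞) {f : M →ₘ[m] ℝ}
    (hf : F.hullEnergy f < ∞) : ∃ (u : ℕ → V) (G : Lp ℝ p m), F.ConvergesTo u f ∧
      Tendsto (fun n => F.g (u n)) atTop (𝓝 G) := by
  obtain ⟨u, C, hae, hC⟩ := (F.hullEnergy_lt_top_iff hp1 hp).1 hf
  obtain ⟨h, G, hh, hG⟩ := F.exists_strong_convex hp1 hp hC
  exact ⟨h, G, tendstoL0_of_ae (F.ae_tendsto_of_convexHull hae hh), hG⟩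

theorem zero_mem_lowerSet (f : M →ₘ[m] ℝ) : 0 ∈ F.lowerSet f :=
  fun _ _ _ hG' => weak_nonneg hG' fun _ => F.g_nonneg _

theorem exists_isGreatest_lowerSet [SigmaFinite m] (hp1 : 1 < p) (hp : p ≠ ∞) {f : M →ₘ[m] ℝ}
    (hf : F.hullEnergy f < ∞) : ∃ G, IsGreatest (F.lowerSet f) G := by
  have hp0 : p ≠ 0 := (zero_lt_one.trans hp1).ne'
  have hr : 0 < p.toReal := ENNReal.toReal_pos hp0 hp
  obtain ⟨u, B, hu, hB⟩ := F.exists_strong_upper hp1 hp hf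
  have hle : ∀ G ∈ F.lowerSet f, G ≤ B := fun G hG => hG u B hu (weak_of_strong hB)
  have hsup : ∀ G ∈ F.lowerSet f, ∀ G' ∈ F.lowerSet f, G ⊔ G' ∈ F.lowerSet f :=
    fun G hG G' hG' w K hw hK => sup_le (hG w K hw hK) (hG' w K hw hK)
  set S : Set ℝ := norm '' {G | G ∈ F.lowerSet f ∧ 0 ≤ G} with hS
  have hSb : ∀ y ∈ S, y ≤ ‖B‖ := by
    rintro _ ⟨G, ⟨hG, hG0⟩, rfl⟩; exact Lp_norm_mono hG0 (hle G hG)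
  have hSbdd : BddAbove S := ⟨‖B‖, hSb⟩
  have hSne : S.Nonempty := ⟨‖(0 : Lp ℝ p m)‖, 0, ⟨F.zero_mem_lowerSet f, le_rfl⟩, rfl⟩
  set c := sSup S with hc
  have hex : ∀ n : ℕ, ∃ G : Lp ℝ p m, (G ∈ F.lowerSet f ∧ 0 ≤ G) ∧
      c - 1 / ((n : ℝ) + 1) < ‖G‖ := by
    intro n
    have hpos : (0 : ℝ) < 1 / ((n : ℝ) + 1) := by positivity
    obtain ⟨_, ⟨w, hw, rfl⟩, hlt⟩ := exists_lt_of_lt_csSup hSne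
      (show c - 1 / ((n : ℝ) + 1) < sSup S by rw [← hc]; linarith)
    exact ⟨w, hw, hlt⟩
  choose K hK hKlt using hex
  set P : ℕ → Lp ℝ p m := fun n => partialSups K n with hP
  have hPmem : ∀ n, P n ∈ F.lowerSet f := by
    intro n
    induction n with
    | zero => simpa [hP] using (hK 0).1
    | succ n ih =>
      have : P (n + 1) = P n ⊔ K (n + 1) := by simp [hP, partialSups_add_one]
      rw [this]; exact hsup _ ih _ (hK _).1
  have hKP : ∀ n, K n ≤ P n := fun n => le_partialSups K n
  have hP0 : ∀ n, 0 ≤ P n := fun n => (hK n).2.trans (hKP n)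
  have hPmono : Monotone P := (partialSups K).monotone
  have hPc : ∀ n, ‖P n‖ ≤ c := fun n => le_csSup hSbdd ⟨P n, ⟨hPmem n, hP0 n⟩, rfl⟩
  have hPlim : Tendsto (fun n => ‖P n‖) atTop (𝓝 c) := by
    refine tendsto_of_tendsto_of_tendsto_of_le_of_le
      (g := fun n : ℕ => c - 1 / ((n : ℝ) + 1)) ?_ tendsto_const_nhds
      (fun n => (hKlt n).le.trans (Lp_norm_mono (hK n).2 (hKP n))) hPc
    simpa using (tendsto_const_nhds (x := c)).sub
      (tendsto_one_div_add_atTop_nhds_zero_nat (𝕜 := ℝ))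
  have hcau : CauchySeq P := by
    refine Lp_cauchySeq_of_midpoint hp1 hp hP0 hPlim (b := fun n => ‖P n‖)
      (fun n => norm_nonneg _) hPlim fun n k hnk => Lp_norm_mono (hP0 n) ?_
    have h1 : P n = (2⁻¹ : ℝ) • (P n + P n) := by
      rw [← two_smul ℝ (P n), smul_smul]; norm_num
    conv_lhs => rw [h1]
    exact Lp_smul_le (by norm_num) (add_le_add_right (hPmono hnk) (P n))
  obtain ⟨G, hG⟩ := cauchySeq_tendsto_of_complete hcau
  have hPG : ∀ n, P n ≤ G := fun n => hPmono.ge_of_tendsto hG n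
  have hG0 : 0 ≤ G := (hP0 0).trans (hPG 0)
  have hGmem : G ∈ F.lowerSet f := fun w W hw hW =>
    le_of_tendsto' hG fun n => hPmem n w W hw hW
  have hGc : ‖G‖ = c := tendsto_nhds_unique hG.norm hPlim
  refine ⟨G, hGmem, fun G' hG' => ?_⟩
  set L := G ⊔ G' with hL
  have hGL : G ≤ L := le_sup_left
  have hL0 : 0 ≤ L := hG0.trans hGL
  have hLc : ‖L‖ = c := le_antisymm (le_csSup hSbdd ⟨L, ⟨hsup _ hGmem _ hG', hL0⟩, rfl⟩)
    (hGc ▸ Lp_norm_mono hG0 hGL)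
  have hmid : c ≤ ‖(2⁻¹ : ℝ) • (L + G)‖ := by
    rw [← hGc]
    refine Lp_norm_mono hG0 ?_
    have h1 : G = (2⁻¹ : ℝ) • (G + G) := by
      rw [← two_smul ℝ G, smul_smul]; norm_num
    conv_lhs => rw [h1]
    exact Lp_smul_le (by norm_num) (add_le_add_left hGL G)
  have hc0 : 0 ≤ c := hGc ▸ norm_nonneg G
  have hLG : ‖L - G‖ = 0 := by
    by_contra hne
    have hpos : 0 < ‖L - G‖ := lt_of_le_of_ne (norm_nonneg _) (Ne.symm hne)
    have hposr : 0 < ‖L - G‖ ^ p.toReal := Real.rpow_pos_of_pos hpos _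
    have hcr : 0 ≤ c ^ p.toReal := Real.rpow_nonneg hc0 _
    have hε : 0 < ‖L - G‖ ^ p.toReal / (4 * (c ^ p.toReal + 1)) := by positivity
    obtain ⟨C, hC, H⟩ := Lp_uniform_convexity (m := m) hp1 hp hε
    have h1 := H L G hL0 hG0
    rw [hLc, hGc] at h1
    have h2 : c ^ p.toReal ≤ ‖(2⁻¹ : ℝ) • (L + G)‖ ^ p.toReal :=
      Real.rpow_le_rpow hc0 hmid hr.le
    have h3 : C * ((c ^ p.toReal + c ^ p.toReal) / 2 - ‖(2⁻¹ : ℝ) • (L + G)‖ ^ p.toReal) ≤ 0 :=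
      mul_nonpos_of_nonneg_of_nonpos hC (by linarith)
    have h4 : ‖L - G‖ ^ p.toReal / (4 * (c ^ p.toReal + 1)) * (4 * (c ^ p.toReal + 1))
        = ‖L - G‖ ^ p.toReal := by field_simp
    nlinarith
  have : L = G := sub_eq_zero.1 (norm_eq_zero.1 hLG)
  exact this ▸ le_sup_right

theorem isGreatest_lowerRelax [SigmaFinite m] (hp1 : 1 < p) (hp : p ≠ ∞) {f : M →ₘ[m] ℝ}
    (hf : F.hullEnergy f < ∞) : IsGreatest (F.lowerSet f) (F.lowerRelax f) := by
  have h := F.exists_isGreatest_lowerSet hp1 hp hf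
  rw [lowerRelax, dif_pos h]
  exact h.choose_spec

theorem exists_upper_add [SigmaFinite m] (hp1 : 1 < p) (hp : p ≠ ∞) {f h : M →ₘ[m] ℝ}
    {u v : ℕ → V} {G1 G2 : Lp ℝ p m} (hu : F.ConvergesTo u f) (hv : F.ConvergesTo v h)
    (hG1 : WeakTendstoLp (fun n => F.g (u n)) G1) (hG2 : WeakTendstoLp (fun n => F.g (v n)) G2) :
    ∃ (w : ℕ → V) (G3 : Lp ℝ p m), F.ConvergesTo w (f + h) ∧
      Tendsto (fun n => F.g (w n)) atTop (𝓝 G3) ∧ G3 ≤ G1 + G2 := by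
  obtain ⟨ns, hns, hae1⟩ := hu.exists_subseq_ae
  obtain ⟨ks, hks, hae2⟩ := (hv.comp hns).exists_subseq_ae
  set u' : ℕ → V := fun n => u (ns (ks n))
  set v' : ℕ → V := fun n => v (ns (ks n))
  have hG1' : WeakTendstoLp (fun n => F.g (u' n)) G1 :=
    fun φ => (hG1 φ).comp (hns.comp hks).tendsto_atTop
  have hG2' : WeakTendstoLp (fun n => F.g (v' n)) G2 :=
    fun φ => (hG2 φ).comp (hns.comp hks).tendsto_atTop
  have hae : ∀ᵐ x ∂m, Tendsto (fun n => F.toL0 (u' n + v' n) x) atTop (𝓝 ((f + h) x)) := by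
    have e : ∀ᵐ x ∂m, ∀ n, (F.toL0 (u' n + v' n)) x = F.toL0 (u' n) x + F.toL0 (v' n) x := by
      refine ae_all_iff.2 fun n => ?_
      rw [map_add]
      exact AEEqFun.coeFn_add _ _
    filter_upwards [hae1, hae2, e, AEEqFun.coeFn_add f h] with x h1 h2 h3 h4
    rw [h4]
    simp only [h3]
    exact (h1.comp hks.tendsto_atTop).add h2
  obtain ⟨C1, hC1⟩ := weak_bounded hG1'
  obtain ⟨C2, hC2⟩ := weak_bounded hG2'
  have hC : ∀ n, ‖F.g (u' n + v' n)‖ ≤ C1 + C2 := fun n =>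
    (Lp_norm_mono (F.g_nonneg _) (F.g_add_le _ _)).trans
      ((norm_add_le _ _).trans (add_le_add (hC1 n) (hC2 n)))
  obtain ⟨w, G3, hw, hG3⟩ := F.exists_strong_convex hp1 hp hC
  refine ⟨w, G3, tendstoL0_of_ae (F.ae_tendsto_of_convexHull hae hw), hG3, ?_⟩
  have hdom : ∀ n, ∃ W ∈ convexHull ℝ ((fun n => F.g (u' n) + F.g (v' n)) '' Ici n),
      F.g (w n) ≤ W := by
    intro n
    refine convexHull_min (t := {w | ∃ W ∈ convexHull ℝ
      ((fun n => F.g (u' n) + F.g (v' n)) '' Ici n), F.g w ≤ W}) ?_ ?_ (hw n)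
    · rintro _ ⟨k, hk, rfl⟩
      exact ⟨_, subset_convexHull ℝ _ (mem_image_of_mem _ hk), F.g_add_le _ _⟩
    · rintro w1 ⟨W1, hW1, h1⟩ w2 ⟨W2, hW2, h2⟩ a b ha hb hab
      refine ⟨a • W1 + b • W2, convex_convexHull ℝ _ hW1 hW2 ha hb hab, ?_⟩
      refine (F.g_add_le _ _).trans ?_
      rw [F.g_smul, F.g_smul, abs_of_nonneg ha, abs_of_nonneg hb]
      exact add_le_add (Lp_smul_le ha h1) (Lp_smul_le hb h2)
  choose W hW hWle using hdom
  have hsum : WeakTendstoLp (fun n => F.g (u' n) + F.g (v' n)) (G1 + G2) := by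
    intro φ; simpa using (hG1' φ).add (hG2' φ)
  exact weak_le (weak_of_strong hG3) (weak_convexHull hsum hW) hWle

/-- The domain of the relaxation: all `f` in `L^0(m)` with finite relaxed energy. -/
def relaxDomain [SigmaFinite m] (hp1 : 1 < p) (hp : p ≠ ∞) : Submodule ℝ (M →ₘ[m] ℝ) where
  carrier := {f | F.hullEnergy f < ∞}
  zero_mem' := by
    refine (F.hullEnergy_lt_top_iff hp1 hp).2 ⟨fun _ => 0, 0, ?_, fun n => by simp [F.g_zero]⟩
    simp
  add_mem' := by
    intro f h hf hh
    obtain ⟨u, G1, hu, hG1⟩ := F.exists_strong_upper hp1 hp hf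
    obtain ⟨v, G2, hv, hG2⟩ := F.exists_strong_upper hp1 hp hh
    obtain ⟨w, G3, hw, hG3, -⟩ := F.exists_upper_add hp1 hp hu hv (weak_of_strong hG1)
      (weak_of_strong hG2)
    obtain ⟨ns, hns, hae⟩ := hw.exists_subseq_ae
    obtain ⟨C, hC⟩ := hG3.norm.bddAbove_range
    exact (F.hullEnergy_lt_top_iff hp1 hp).2 ⟨_, C, hae, fun n => hC ⟨ns n, rfl⟩⟩
  smul_mem' := by
    intro c f hf
    obtain ⟨u, C, hae, hC⟩ := (F.hullEnergy_lt_top_iff hp1 hp).1 hf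
    refine (F.hullEnergy_lt_top_iff hp1 hp).2 ⟨fun n => c • u n, |c| * C, ?_, fun n => ?_⟩
    · have e : ∀ᵐ x ∂m, ∀ n, (F.toL0 (c • u n)) x = c * F.toL0 (u n) x := by
        refine ae_all_iff.2 fun n => ?_
        rw [map_smul]
        exact AEEqFun.coeFn_smul _ _
      filter_upwards [hae, e, AEEqFun.coeFn_smul c f] with x h1 h2 h3
      rw [h3]
      simp only [h2]
      exact h1.const_mul c
    · rw [F.g_smul, norm_smul, Real.norm_eq_abs, abs_abs]
      exact mul_le_mul_of_nonneg_left (hC n) (abs_nonneg c)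

theorem lowerRelax_add_le [SigmaFinite m] (hp1 : 1 < p) (hp : p ≠ ∞) {f h : M →ₘ[m] ℝ}
    (hf : F.hullEnergy f < ∞) (hh : F.hullEnergy h < ∞) :
    F.lowerRelax (f + h) ≤ F.lowerRelax f + F.lowerRelax h := by
  have hfh : F.hullEnergy (f + h) < ∞ := (F.relaxDomain hp1 hp).add_mem hf hh
  have H := (F.isGreatest_lowerRelax hp1 hp hfh).1
  have h1 : ∀ (u : ℕ → V) (G1 : Lp ℝ p m), F.ConvergesTo u f →
      WeakTendstoLp (fun n => F.g (u n)) G1 → F.lowerRelax (f + h) - G1 ≤ F.lowerRelax h := by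
    intro u G1 hu hG1
    refine (F.isGreatest_lowerRelax hp1 hp hh).2 fun v G2 hv hG2 => ?_
    obtain ⟨w, G3, hw, hG3, hle⟩ := F.exists_upper_add hp1 hp hu hv hG1 hG2
    exact sub_le_iff_le_add'.2 ((H w G3 hw (weak_of_strong hG3)).trans hle)
  have h2 : F.lowerRelax (f + h) - F.lowerRelax h ≤ F.lowerRelax f := by
    refine (F.isGreatest_lowerRelax hp1 hp hf).2 fun u G1 hu hG1 => ?_
    exact sub_le_comm.1 (h1 u G1 hu hG1)
  exact sub_le_iff_le_add.1 h2

theorem lowerRelax_zero [SigmaFinite m] (hp1 : 1 < p) (hp : p ≠ ∞) : F.lowerRelax 0 = 0 := by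
  have h0 : F.hullEnergy 0 < ∞ := (F.relaxDomain hp1 hp).zero_mem
  refine le_antisymm ?_ ((F.isGreatest_lowerRelax hp1 hp h0).2 (F.zero_mem_lowerSet 0))
  refine (F.isGreatest_lowerRelax hp1 hp h0).1 (fun _ => 0) 0 ?_ ?_
  · exact tendstoL0_of_ae (by simp)
  · intro φ; simp [F.g_zero]

theorem smul_mem_lowerSet {c : ℝ} (hc : c ≠ 0) {f : M →ₘ[m] ℝ} {G : Lp ℝ p m}
    [SigmaFinite m] (hG : G ∈ F.lowerSet f) : |c| • G ∈ F.lowerSet (c • f) := by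
  intro u G' hu hG'
  obtain ⟨ns, hns, hae⟩ := hu.exists_subseq_ae
  have hconv : F.ConvergesTo (fun n => c⁻¹ • u (ns n)) f := by
    refine tendstoL0_of_ae ?_
    have e : ∀ᵐ x ∂m, ∀ n, (F.toL0 (c⁻¹ • u (ns n))) x = c⁻¹ * F.toL0 (u (ns n)) x := by
      refine ae_all_iff.2 fun n => ?_
      rw [map_smul]
      exact AEEqFun.coeFn_smul _ _
    filter_upwards [hae, e, AEEqFun.coeFn_smul c f] with x h1 h2 h3
    simp only [h2]
    rw [h3, Pi.smul_apply, smul_eq_mul] at h1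
    have := h1.const_mul c⁻¹
    rwa [inv_mul_cancel_left₀ hc] at this
  have hw : WeakTendstoLp (fun n => F.g (c⁻¹ • u (ns n))) (|c|⁻¹ • G') := by
    intro φ
    simp only [F.g_smul, map_smul, abs_inv]
    exact ((hG' φ).comp hns.tendsto_atTop).const_smul _
  have h := Lp_smul_le (abs_nonneg c) (hG _ _ hconv hw)
  rwa [smul_smul, mul_inv_cancel₀ (abs_ne_zero.2 hc), one_smul] at h

theorem lowerRelax_smul [SigmaFinite m] (hp1 : 1 < p) (hp : p ≠ ∞) (c : ℝ) {f : M →ₘ[m] ℝ}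
    (hf : F.hullEnergy f < ∞) : F.lowerRelax (c • f) = |c| • F.lowerRelax f := by
  rcases eq_or_ne c 0 with rfl | hc
  · simp [F.lowerRelax_zero hp1 hp]
  have hcf : F.hullEnergy (c • f) < ∞ := (F.relaxDomain hp1 hp).smul_mem c hf
  have H := F.isGreatest_lowerRelax hp1 hp hf
  have Hc := F.isGreatest_lowerRelax hp1 hp hcf
  refine le_antisymm ?_ (Hc.2 (F.smul_mem_lowerSet hc H.1))
  have h1 := F.smul_mem_lowerSet (inv_ne_zero hc) Hc.1
  rw [inv_smul_smul₀ hc] at h1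
  have h2 := Lp_smul_le (abs_nonneg c) (H.2 h1)
  rwa [smul_smul, abs_inv, mul_inv_cancel₀ (abs_ne_zero.2 hc), one_smul] at h2

/-- The lower relaxation, as an `L^p`-valued functional on the relaxed domain. -/
noncomputable def relax [SigmaFinite m] (hp1 : 1 < p) (hp : p ≠ ∞) :
    LpFunctional m p (F.relaxDomain hp1 hp) where
  toL0 := (F.relaxDomain hp1 hp).subtype
  g f := F.lowerRelax f
  g_nonneg f := (F.isGreatest_lowerRelax hp1 hp f.2).2 (F.zero_mem_lowerSet f)
  g_add_le f h := F.lowerRelax_add_le hp1 hp f.2 h.2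
  g_smul c f := F.lowerRelax_smul hp1 hp c f.2

/-- Every `f` in the domain of the functional lies in the domain of its relaxation. -/
noncomputable def toRelaxDomain [SigmaFinite m] (hp1 : 1 < p) (hp : p ≠ ∞) :
    V →ₗ[ℝ] F.relaxDomain hp1 hp :=
  F.toL0.codRestrict (F.relaxDomain hp1 hp) fun f =>
    (F.hullEnergy_lt_top_iff hp1 hp).2 ⟨fun _ => f, ‖F.g f‖, by simp, fun _ => le_rfl⟩

end RelaxFunctional

end LpFunctional

/-! ### The module generated by an `L^p`-valued functional -/

namespace LpFunctional

/-- The countably valued approximation `⌊(n + 1) a⌋ / (n + 1)` of `a`. -/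
noncomputable def approx {M : Type*} (a : M → ℝ) (n : ℕ) (x : M) : ℝ := ⌊((n : ℝ) + 1) * a x⌋ / ((n : ℝ) + 1)

theorem abs_approx_sub_le {M : Type*} (a : M → ℝ) (n : ℕ) (x : M) :
    |approx a n x - a x| ≤ 1 / ((n : ℝ) + 1) := by
  have hn : (0 : ℝ) < (n : ℝ) + 1 := by positivity
  have h1 := Int.floor_le (((n : ℝ) + 1) * a x)
  have h2 := Int.lt_floor_add_one (((n : ℝ) + 1) * a x)
  have e : approx a n x - a x =
      (⌊((n : ℝ) + 1) * a x⌋ - ((n : ℝ) + 1) * a x) / ((n : ℝ) + 1) := by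
    rw [approx]; field_simp
  rw [e, abs_div, abs_of_pos hn]
  refine div_le_div_of_nonneg_right ?_ hn.le
  rw [abs_le]; constructor <;> linarith

section Pfm
variable {M : Type*} [MeasurableSpace M] {m : Measure M} {p : ℝ≥0∞} [Fact (1 ≤ p)]
  {V : Type*} [AddCommGroup V] [Module ℝ V] (F : LpFunctional m p V)

/-- The map `s : M → V` takes countably many values, on measurable sets. Such a map is the same
as a family `{(f_i, A_i)}` with `(A_i)` a countable measurable partition: `s = f_i` on `A_i`. -/
def IsCountablyValued {W : Type*} (s : M → W) : Prop :=
  (range s).Countable ∧ ∀ v, MeasurableSet (s ⁻¹' {v})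

theorem IsCountablyValued.measurableSet_preimage {W : Type*} {s : M → W}
    (hs : IsCountablyValued s) (B : Set W) : MeasurableSet (s ⁻¹' B) := by
  have : s ⁻¹' B = ⋃ v ∈ B ∩ range s, s ⁻¹' {v} := by
    ext x; simp
  rw [this]
  exact MeasurableSet.biUnion (hs.1.mono inter_subset_right) fun v _ => hs.2 v

theorem IsCountablyValued.comp₂ {W₁ W₂ W : Type*} {s : M → W₁} {t : M → W₂}
    (hs : IsCountablyValued s) (ht : IsCountablyValued t) (φ : W₁ → W₂ → W) :
    IsCountablyValued fun x => φ (s x) (t x) := by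
  refine ⟨(hs.1.image2 ht.1 φ).mono ?_, fun v => ?_⟩
  · rintro _ ⟨x, rfl⟩
    exact ⟨s x, ⟨x, rfl⟩, t x, ⟨x, rfl⟩, rfl⟩
  · have : (fun x => φ (s x) (t x)) ⁻¹' {v} =
        ⋃ a ∈ range s, s ⁻¹' {a} ∩ t ⁻¹' {b | φ a b = v} := by
      ext x
      simp only [mem_preimage, mem_singleton_iff, mem_iUnion, mem_inter_iff]
      exact ⟨fun h => ⟨s x, ⟨x, rfl⟩, rfl, h⟩, fun ⟨a, _, ha, h⟩ => by rw [ha]; exact h⟩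
    rw [this]
    exact MeasurableSet.biUnion hs.1 fun a _ => (hs.2 a).inter (ht.measurableSet_preimage _)

/-- The function equal to `g_{f_i}` on `A_i`. -/
noncomputable def pointwise (s : M → V) (x : M) : ℝ := F.g (s x) x

theorem aestronglyMeasurable_pointwise {s : M → V} (hs : IsCountablyValued s) :
    AEStronglyMeasurable (F.pointwise s) m := by
  have hm : Measurable (F.pointwise s) := by
    intro B hB
    have : F.pointwise s ⁻¹' B = ⋃ v ∈ range s, s ⁻¹' {v} ∩ (F.g v : M → ℝ) ⁻¹' B := by
      ext x
      simp only [mem_preimage, mem_singleton_iff, mem_iUnion, mem_inter_iff]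
      exact ⟨fun h => ⟨s x, ⟨x, rfl⟩, rfl, h⟩, fun ⟨a, _, ha, h⟩ => by
        rw [pointwise, ha]; exact h⟩
    rw [this]
    exact MeasurableSet.biUnion hs.1 fun v _ =>
      (hs.2 v).inter ((Lp.stronglyMeasurable (F.g v)).measurable hB)
  exact hm.aestronglyMeasurable

theorem pointwise_nonneg {s : M → V} (hs : IsCountablyValued s) :
    ∀ᵐ x ∂m, 0 ≤ F.pointwise s x := by
  have : ∀ᵐ x ∂m, ∀ v ∈ range s, 0 ≤ F.g v x :=
    (ae_ball_iff hs.1).2 fun v _ => (Lp.coeFn_nonneg (F.g v)).2 (F.g_nonneg v)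
  filter_upwards [this] with x h using h _ ⟨x, rfl⟩

theorem pointwise_add_le {s t : M → V} (hs : IsCountablyValued s) (ht : IsCountablyValued t) :
    ∀ᵐ x ∂m, F.pointwise (s + t) x ≤ F.pointwise s x + F.pointwise t x := by
  have : ∀ᵐ x ∂m, ∀ v ∈ range s, ∀ w ∈ range t, F.g (v + w) x ≤ F.g v x + F.g w x := by
    refine (ae_ball_iff hs.1).2 fun v _ => (ae_ball_iff ht.1).2 fun w _ => ?_
    have := (Lp.coeFn_le _ _).2 (F.g_add_le v w)
    filter_upwards [this, Lp.coeFn_add (F.g v) (F.g w)] with x h1 h2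
    rw [h2] at h1; exact h1
  filter_upwards [this] with x h using h _ ⟨x, rfl⟩ _ ⟨x, rfl⟩

theorem pointwise_smul {a : M → ℝ} {s : M → V} (ha : IsCountablyValued a)
    (hs : IsCountablyValued s) :
    ∀ᵐ x ∂m, F.pointwise (fun x => a x • s x) x = |a x| * F.pointwise s x := by
  have : ∀ᵐ x ∂m, ∀ c ∈ range a, ∀ v ∈ range s, F.g (c • v) x = |c| * F.g v x := by
    refine (ae_ball_iff ha.1).2 fun c _ => (ae_ball_iff hs.1).2 fun v _ => ?_
    rw [F.g_smul]
    exact Lp.coeFn_smul |c| (F.g v)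
  filter_upwards [this] with x h using h _ ⟨x, rfl⟩ _ ⟨x, rfl⟩

theorem isCountablyValued_const {W : Type*} (w : W) : IsCountablyValued fun _ : M => w :=
  ⟨(countable_singleton w).mono (by rintro _ ⟨x, rfl⟩; rfl),
    fun v => by by_cases h : w = v <;> simp [h]⟩

/-- The families `{(f_i, A_i)}` with `∑ ∫_{A_i} g_{f_i} ^ p < ∞`, as a vector space. -/
def pfm : Submodule ℝ (M → V) where
  carrier := {s | IsCountablyValued s ∧ MemLp (F.pointwise s) p m}
  zero_mem' := by
    refine ⟨isCountablyValued_const 0, ?_⟩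
    have : F.pointwise (0 : M → V) = F.g 0 := rfl
    rw [this]; exact Lp.memLp _
  add_mem' := by
    rintro s t ⟨hs, hs'⟩ ⟨ht, ht'⟩
    have hst : IsCountablyValued (s + t) := hs.comp₂ ht (· + ·)
    refine ⟨hst, (hs'.add ht').mono (F.aestronglyMeasurable_pointwise hst) ?_⟩
    filter_upwards [F.pointwise_add_le hs ht, F.pointwise_nonneg hst, F.pointwise_nonneg hs,
      F.pointwise_nonneg ht] with x h1 h2 h3 h4
    rw [Pi.add_apply, Real.norm_of_nonneg h2, Real.norm_of_nonneg (add_nonneg h3 h4)]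
    exact h1
  smul_mem' := by
    rintro c s ⟨hs, hs'⟩
    have hcs : IsCountablyValued (c • s) := (isCountablyValued_const c).comp₂ hs (· • ·)
    refine ⟨hcs, (hs'.const_mul |c|).mono (F.aestronglyMeasurable_pointwise hcs) ?_⟩
    filter_upwards [F.pointwise_smul (isCountablyValued_const c) hs] with x h1
    exact (congrArg norm h1).le

/-- `pfm` as a type, carrying the seminorm `‖s‖ = ‖ |s| ‖_{L^p}`. -/
def Pfm : Type _ := F.pfm

noncomputable instance : AddCommGroup F.Pfm := inferInstanceAs (AddCommGroup F.pfm)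
noncomputable instance : Module ℝ F.Pfm := inferInstanceAs (Module ℝ F.pfm)

/-- The underlying map of an element of `Pfm`. -/
def Pfm.val {F : LpFunctional m p V} (s : F.Pfm) : M → V := Subtype.val s

/-- The pointwise norm `|s|` as an element of `L^p(m)`. -/
noncomputable def Pfm.pointwiseNorm {F : LpFunctional m p V} (s : F.Pfm) : Lp ℝ p m :=
  MemLp.toLp (F.pointwise s.val) s.2.2

theorem Pfm.coeFn_pointwiseNorm {F : LpFunctional m p V} (s : F.Pfm) :
    s.pointwiseNorm =ᵐ[m] F.pointwise s.val := MemLp.coeFn_toLp _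

theorem Pfm.pointwiseNorm_nonneg {F : LpFunctional m p V} (s : F.Pfm) : 0 ≤ s.pointwiseNorm := by
  rw [← Lp.coeFn_nonneg]
  filter_upwards [s.coeFn_pointwiseNorm, F.pointwise_nonneg s.2.1] with x h1 h2
  rw [h1]; exact h2

theorem Pfm.pointwiseNorm_add_le {F : LpFunctional m p V} (s t : F.Pfm) :
    (s + t).pointwiseNorm ≤ s.pointwiseNorm + t.pointwiseNorm := by
  rw [← Lp.coeFn_le]
  filter_upwards [s.coeFn_pointwiseNorm, t.coeFn_pointwiseNorm, (s + t).coeFn_pointwiseNorm,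
    Lp.coeFn_add s.pointwiseNorm t.pointwiseNorm, F.pointwise_add_le s.2.1 t.2.1]
    with x h1 h2 h3 h4 h5
  rw [h3, h4, Pi.add_apply, h1, h2]; exact h5

theorem Pfm.pointwiseNorm_smul {F : LpFunctional m p V} (c : ℝ) (s : F.Pfm) :
    (c • s).pointwiseNorm = |c| • s.pointwiseNorm := by
  refine Lp.ext ?_
  filter_upwards [s.coeFn_pointwiseNorm, (c • s).coeFn_pointwiseNorm,
    Lp.coeFn_smul |c| s.pointwiseNorm, F.pointwise_smul (isCountablyValued_const c) s.2.1]
    with x h1 h2 h3 h4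
  rw [h2, h3, Pi.smul_apply, h1]; exact h4

noncomputable instance : Norm F.Pfm := ⟨fun s => ‖s.pointwiseNorm‖⟩

theorem Pfm.norm_def {F : LpFunctional m p V} (s : F.Pfm) : ‖s‖ = ‖s.pointwiseNorm‖ := rfl

theorem Pfm.core : SeminormedSpace.Core ℝ F.Pfm where
  norm_nonneg s := norm_nonneg s.pointwiseNorm
  norm_smul c s := by
    rw [Pfm.norm_def, Pfm.norm_def, Pfm.pointwiseNorm_smul, norm_smul, Real.norm_eq_abs, abs_abs,
      Real.norm_eq_abs]
  norm_triangle s t :=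
    (Lp_norm_mono (s + t).pointwiseNorm_nonneg (s.pointwiseNorm_add_le t)).trans (norm_add_le _ _)

noncomputable instance : SeminormedAddCommGroup F.Pfm := SeminormedAddCommGroup.ofCore (Pfm.core F)

noncomputable instance : NormedSpace ℝ F.Pfm where
  norm_smul_le c s := ((Pfm.core F).norm_smul c s).le

/-- The `F`-module: the (separated) completion of `Pfm`. -/
abbrev LpModule : Type _ := UniformSpace.Completion F.Pfm

/-- The differential `d f = [f, M]`, on the dense subspace. -/
noncomputable def dPfm : V →ₗ[ℝ] F.Pfm where
  toFun f := ⟨fun _ => f, isCountablyValued_const f, Lp.memLp (F.g f)⟩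
  map_add' _ _ := rfl
  map_smul' _ _ := rfl

/-- The differential `d f = [f, M]`. -/
noncomputable def d (f : V) : F.LpModule := (F.dPfm f : F.Pfm)

theorem Pfm.lipschitz_pointwiseNorm :
    LipschitzWith 1 (Pfm.pointwiseNorm : F.Pfm → Lp ℝ p m) := by
  refine LipschitzWith.of_dist_le_mul fun s t => ?_
  rw [NNReal.coe_one, one_mul, dist_eq_norm, dist_eq_norm, Pfm.norm_def]
  refine norm_le_norm_of_abs_le_abs ?_
  rw [abs_of_nonneg (s - t).pointwiseNorm_nonneg]
  have h1 := Pfm.pointwiseNorm_add_le (s - t) t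
  have h2 := Pfm.pointwiseNorm_add_le (t - s) s
  have h3 : (t - s).pointwiseNorm = (s - t).pointwiseNorm := by
    have := Pfm.pointwiseNorm_smul (-1) (s - t)
    rw [neg_smul, one_smul, neg_sub, abs_neg, abs_one, one_smul] at this
    exact this
  rw [sub_add_cancel] at h1 h2
  rw [h3] at h2
  exact abs_le'.2 ⟨sub_le_iff_le_add.2 h1, by rw [neg_sub]; exact sub_le_iff_le_add.2 h2⟩

/-- The pointwise norm `|·|` of the `F`-module, extended by continuity. -/
noncomputable def pointwiseNorm (v : F.LpModule) : Lp ℝ p m :=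
  UniformSpace.Completion.extension (Pfm.pointwiseNorm : F.Pfm → Lp ℝ p m) v

theorem isCountablyValued_approx {a : M → ℝ} (ha : Measurable a) (n : ℕ) :
    IsCountablyValued (approx a n) := by
  have h1 : Measurable (approx a n) := by
    have : Measurable fun x => ⌊((n : ℝ) + 1) * a x⌋ := (ha.const_mul _).floor
    exact ((measurable_from_top (f := fun k : ℤ => (k : ℝ))).comp this).div_const _
  refine ⟨(countable_range fun k : ℤ => (k : ℝ) / ((n : ℝ) + 1)).mono ?_,
    fun v => h1 (measurableSet_singleton v)⟩
  rintro _ ⟨x, rfl⟩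
  exact ⟨⌊((n : ℝ) + 1) * a x⌋, rfl⟩

theorem ae_abs_le (a : Lp ℝ ∞ m) : ∀ᵐ x ∂m, |a x| ≤ ‖a‖ := by
  have h := ae_le_eLpNormEssSup (f := (a : M → ℝ)) (μ := m)
  filter_upwards [h] with x hx
  rw [Lp.norm_def, eLpNorm_exponent_top, ← Real.norm_eq_abs, ← toReal_enorm]
  refine ENNReal.toReal_mono ?_ hx
  rw [← eLpNorm_exponent_top]; exact Lp.eLpNorm_ne_top a

/-- Multiplication of `s` in `Pfm` by the countably valued approximation `approx a n`,
i.e. `[(f_i, A_i)] ↦ [(a_j f_i, A_i ∩ B_j)]`. -/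
noncomputable def approxMul (a : Lp ℝ ∞ m) (n : ℕ) : F.Pfm →ₗ[ℝ] F.Pfm where
  toFun s := ⟨fun x => approx a n x • s.val x, by
    have ha := isCountablyValued_approx (Lp.stronglyMeasurable a).measurable n
    have hc := ha.comp₂ s.2.1 (· • ·)
    refine ⟨hc, (s.2.2.const_mul (‖a‖ + 1)).mono (F.aestronglyMeasurable_pointwise hc) ?_⟩
    filter_upwards [F.pointwise_smul ha s.2.1, ae_abs_le a] with x h1 h2
    refine (congrArg norm h1).le.trans ?_
    have h6 : ‖‖a‖ + 1‖ = ‖a‖ + 1 := Real.norm_of_nonneg (add_nonneg (norm_nonneg a) zero_le_one)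
    rw [norm_mul, norm_mul, h6, Real.norm_eq_abs, abs_abs]
    refine mul_le_mul_of_nonneg_right ?_ (norm_nonneg _)
    have h3 := abs_approx_sub_le a n x
    have h4 : 1 / ((n : ℝ) + 1) ≤ 1 := by
      rw [div_le_one (by positivity)]; linarith [(Nat.cast_nonneg n : (0 : ℝ) ≤ n)]
    have h5 := abs_sub_abs_le_abs_sub (approx a n x) (a x)
    linarith⟩
  map_add' s t := Subtype.ext <| funext fun x => smul_add _ _ _
  map_smul' c s := Subtype.ext <| funext fun x => smul_comm _ _ _

theorem norm_approxMul_sub_le (a : Lp ℝ ∞ m) (n k : ℕ) (s : F.Pfm) :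
    ‖F.approxMul a n s - F.approxMul a k s‖ ≤
      (1 / ((n : ℝ) + 1) + 1 / ((k : ℝ) + 1)) * ‖s‖ := by
  set c : ℝ := 1 / ((n : ℝ) + 1) + 1 / ((k : ℝ) + 1) with hc
  have hc0 : 0 ≤ c := by positivity
  have hn := isCountablyValued_approx (Lp.stronglyMeasurable a).measurable n
  have hk := isCountablyValued_approx (Lp.stronglyMeasurable a).measurable k
  rw [Pfm.norm_def, Pfm.norm_def]
  refine Lp.norm_le_mul_norm_of_ae_le_mul ?_
  filter_upwards [s.coeFn_pointwiseNorm, (F.approxMul a n s - F.approxMul a k s).coeFn_pointwiseNorm,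
    F.pointwise_smul (hn.comp₂ hk (· - ·)) s.2.1] with x h1 h2 h3
  have e : (F.approxMul a n s - F.approxMul a k s).val =
      fun x => (approx a n x - approx a k x) • s.val x :=
    funext fun x => (sub_smul _ _ _).symm
  rw [h2, e, h1]
  refine (congrArg norm h3).le.trans ?_
  rw [norm_mul, Real.norm_eq_abs, abs_abs]
  refine mul_le_mul_of_nonneg_right ?_ (norm_nonneg _)
  have h4 := abs_approx_sub_le a n x
  have h5 := abs_approx_sub_le a k x
  rw [abs_le] at h4 h5 ⊢
  constructor <;> linarith

theorem norm_approxMul_le (a : Lp ℝ ∞ m) (n : ℕ) (s : F.Pfm) :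
    ‖F.approxMul a n s‖ ≤ (‖a‖ + 1) * ‖s‖ := by
  have hn := isCountablyValued_approx (Lp.stronglyMeasurable a).measurable n
  rw [Pfm.norm_def, Pfm.norm_def]
  refine Lp.norm_le_mul_norm_of_ae_le_mul ?_
  filter_upwards [s.coeFn_pointwiseNorm, (F.approxMul a n s).coeFn_pointwiseNorm,
    F.pointwise_smul hn s.2.1, ae_abs_le a] with x h1 h2 h3 h4
  rw [h1, h2]
  refine (congrArg norm h3).le.trans ?_
  rw [norm_mul, Real.norm_eq_abs, abs_abs]
  refine mul_le_mul_of_nonneg_right ?_ (norm_nonneg _)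
  have h5 := abs_approx_sub_le a n x
  have h6 : 1 / ((n : ℝ) + 1) ≤ 1 := by
    rw [div_le_one (by positivity)]; linarith [(Nat.cast_nonneg n : (0 : ℝ) ≤ n)]
  have h7 := abs_sub_abs_le_abs_sub (approx a n x) (a x)
  linarith

theorem uniformContinuous_approxMul (a : Lp ℝ ∞ m) (n : ℕ) :
    UniformContinuous (F.approxMul a n) :=
  ((F.approxMul a n).mkContinuous (‖a‖ + 1) (F.norm_approxMul_le a n)).uniformContinuous

/-- Multiplication of elements of the `F`-module by `L^∞`-functions, extended by continuity from
`Pfm` and from countably valued functions (the limit exists, see `tendsto_linftyMul`). -/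
noncomputable def linftyMul (a : Lp ℝ ∞ m) (v : F.LpModule) : F.LpModule :=
  limUnder atTop fun n => UniformSpace.Completion.map (F.approxMul a n) v

theorem tendsto_linftyMul (a : Lp ℝ ∞ m) (v : F.LpModule) :
    Tendsto (fun n => UniformSpace.Completion.map (F.approxMul a n) v) atTop
      (𝓝 (F.linftyMul a v)) := by
  have hbound : ∀ (n k : ℕ) (w : F.LpModule),
      ‖UniformSpace.Completion.map (F.approxMul a n) w -
        UniformSpace.Completion.map (F.approxMul a k) w‖ ≤
      (1 / ((n : ℝ) + 1) + 1 / ((k : ℝ) + 1)) * ‖w‖ := by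
    intro n k w
    induction w using UniformSpace.Completion.induction_on with
    | hp =>
      have h1 : Continuous (UniformSpace.Completion.map (F.approxMul a n)) :=
        UniformSpace.Completion.continuous_map
      have h2 : Continuous (UniformSpace.Completion.map (F.approxMul a k)) :=
        UniformSpace.Completion.continuous_map
      exact isClosed_le (h1.sub h2).norm (continuous_const.mul continuous_norm)
    | ih s =>
      rw [UniformSpace.Completion.map_coe (F.uniformContinuous_approxMul a n),
        UniformSpace.Completion.map_coe (F.uniformContinuous_approxMul a k),
        ← UniformSpace.Completion.coe_sub, UniformSpace.Completion.norm_coe,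
        UniformSpace.Completion.norm_coe]
      exact F.norm_approxMul_sub_le a n k s
  have hcau : CauchySeq fun n => UniformSpace.Completion.map (F.approxMul a n) v := by
    refine cauchySeq_of_le_tendsto_0 (fun n : ℕ => 2 * (1 / ((n : ℝ) + 1)) * ‖v‖) ?_ ?_
    · intro n k N hn hk
      rw [dist_eq_norm]
      refine (hbound n k v).trans (mul_le_mul_of_nonneg_right ?_ (norm_nonneg v))
      have h1 : 1 / ((n : ℝ) + 1) ≤ 1 / ((N : ℝ) + 1) := Nat.one_div_le_one_div hn
      have h2 : 1 / ((k : ℝ) + 1) ≤ 1 / ((N : ℝ) + 1) := Nat.one_div_le_one_div hk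
      linarith
    · simpa using ((tendsto_one_div_add_atTop_nhds_zero_nat (𝕜 := ℝ)).const_mul 2).mul_const ‖v‖
  exact hcau.tendsto_limUnder

theorem pointwiseNorm_coe (s : F.Pfm) : F.pointwiseNorm (s : F.LpModule) = s.pointwiseNorm :=
  UniformSpace.Completion.extension_coe (Pfm.lipschitz_pointwiseNorm F).uniformContinuous s

end Pfm

end LpFunctional

/-! ### The local Lipschitz constant -/

section Lip
variable {M : Type*} [MetricSpace M]

/-- The local Lipschitz constant `limsup_{y → x} |f y - f x| / d(y, x)`
(equal to `0` at isolated points). -/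
noncomputable def elip (f : M → ℝ) (x : M) : ℝ≥0∞ :=
  limsup (fun y => edist (f y) (f x) / edist y x) (𝓝[≠] x)

/-- The local Lipschitz constant as a real number (finite for Lipschitz `f`). -/
noncomputable def lip (f : M → ℝ) (x : M) : ℝ := (elip f x).toReal

theorem elip_le {f : M → ℝ} {K : ℝ≥0} (hf : LipschitzWith K f) (x : M) : elip f x ≤ K := by
  refine limsup_le_of_le (by isBoundedDefault) ?_
  exact Eventually.of_forall fun y => ENNReal.div_le_of_le_mul (hf y x)

theorem elip_add_le (f h : M → ℝ) (x : M) : elip (f + h) x ≤ elip f x + elip h x := by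
  refine ENNReal.le_of_forall_pos_le_add fun ε hε htop => ?_
  obtain ⟨h1, h2⟩ := ENNReal.add_lt_top.1 htop
  have hε2 : (ε : ℝ≥0∞) / 2 ≠ 0 := (ENNReal.half_pos (by exact_mod_cast hε.ne')).ne'
  have e1 := eventually_lt_of_limsup_lt (ENNReal.lt_add_right h1.ne hε2)
  have e2 := eventually_lt_of_limsup_lt (ENNReal.lt_add_right h2.ne hε2)
  refine limsup_le_of_le (by isBoundedDefault) ?_
  filter_upwards [e1, e2] with y h3 h4
  calc edist ((f + h) y) ((f + h) x) / edist y x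
      ≤ (edist (f y) (f x) + edist (h y) (h x)) / edist y x :=
        ENNReal.div_le_div_right (edist_add_add_le _ _ _ _) _
    _ = edist (f y) (f x) / edist y x + edist (h y) (h x) / edist y x := ENNReal.add_div
    _ ≤ (elip f x + ε / 2) + (elip h x + ε / 2) := add_le_add h3.le h4.le
    _ = elip f x + elip h x + (ε / 2 + ε / 2) := by ring
    _ = elip f x + elip h x + ε := by rw [ENNReal.add_halves]

theorem elip_smul (c : ℝ) (f : M → ℝ) (x : M) : elip (c • f) x = ENNReal.ofReal |c| * elip f x := by
  have e : ∀ y, edist ((c • f) y) ((c • f) x) / edist y x =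
      ENNReal.ofReal |c| * (edist (f y) (f x) / edist y x) := by
    intro y
    rw [← mul_div_assoc]
    congr 1
    simp only [Pi.smul_apply, smul_eq_mul, edist_dist, Real.dist_eq, ← mul_sub, abs_mul]
    exact ENNReal.ofReal_mul (abs_nonneg c)
  simp only [elip, e]
  exact ENNReal.limsup_const_mul_of_ne_top ENNReal.ofReal_ne_top

theorem elip_ne_top {f : M → ℝ} (hf : ∃ K, LipschitzWith K f) (x : M) : elip f x ≠ ∞ := by
  obtain ⟨K, hK⟩ := hf
  exact ((elip_le hK x).trans_lt ENNReal.coe_lt_top).ne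

theorem lip_add_le {f h : M → ℝ} (hf : ∃ K, LipschitzWith K f) (hh : ∃ K, LipschitzWith K h)
    (x : M) : lip (f + h) x ≤ lip f x + lip h x := by
  rw [lip, lip, lip, ← ENNReal.toReal_add (elip_ne_top hf x) (elip_ne_top hh x)]
  exact ENNReal.toReal_mono (ENNReal.add_ne_top.2 ⟨elip_ne_top hf x, elip_ne_top hh x⟩)
    (elip_add_le f h x)

theorem lip_smul (c : ℝ) (f : M → ℝ) (x : M) : lip (c • f) x = |c| * lip f x := by
  rw [lip, lip, elip_smul, ENNReal.toReal_mul, ENNReal.toReal_ofReal (abs_nonneg c)]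

theorem lip_nonneg (f : M → ℝ) (x : M) : 0 ≤ lip f x := ENNReal.toReal_nonneg

theorem measurable_elip [MeasurableSpace M] [BorelSpace M] {f : M → ℝ} (hf : Continuous f) :
    Measurable (elip f) := by
  have key : ∀ x, elip f x = ⨅ n : ℕ, ⨆ y ∈ {y | y ≠ x ∧ edist y x < ((n : ℝ≥0∞) + 1)⁻¹},
      edist (f y) (f x) / edist y x := by
    intro x
    have hb : (𝓝[≠] x).HasBasis (fun _ : ℕ => True)
        (fun n => {y | y ≠ x ∧ edist y x < ((n : ℝ≥0∞) + 1)⁻¹}) := by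
      refine hasBasis_iff.2 fun t => ?_
      rw [mem_nhdsWithin_iff_exists_mem_nhds_inter]
      constructor
      · rintro ⟨u, hu, hut⟩
        obtain ⟨δ, hδ, hball⟩ := EMetric.mem_nhds_iff.1 hu
        obtain ⟨n, hn⟩ := ENNReal.exists_inv_nat_lt hδ.ne'
        refine ⟨n, trivial, fun y hy => hut ⟨hball ?_, hy.1⟩⟩
        refine lt_of_lt_of_le hy.2 (le_trans ?_ hn.le)
        exact ENNReal.inv_le_inv.2 le_self_add
      · rintro ⟨n, -, hn⟩
        refine ⟨Metric.eball x ((n : ℝ≥0∞) + 1)⁻¹, Metric.eball_mem_nhds _ ?_,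
          fun y hy => hn ⟨hy.2, hy.1⟩⟩
        exact ENNReal.inv_pos.2 (by finiteness)
    simp only [elip, hb.limsup_eq_iInf_iSup, iInf_true]
  have : elip f = fun x => ⨅ n : ℕ, ⨆ y ∈ {y | y ≠ x ∧ edist y x < ((n : ℝ≥0∞) + 1)⁻¹},
      edist (f y) (f x) / edist y x := funext key
  rw [this]
  refine Measurable.iInf fun n => LowerSemicontinuous.measurable ?_
  intro x c hc
  simp only [lt_iSup_iff] at hc
  obtain ⟨y, ⟨hy1, hy2⟩, hy3⟩ := hc
  have h1 : ∀ᶠ z in 𝓝 x, y ≠ z := by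
    filter_upwards [isOpen_ne.mem_nhds (Ne.symm hy1)] with z hz using Ne.symm hz
  have h2 : ∀ᶠ z in 𝓝 x, edist y z < ((n : ℝ≥0∞) + 1)⁻¹ :=
    (continuous_const.edist continuous_id).tendsto x |>.eventually_lt_const hy2
  have h3 : ∀ᶠ z in 𝓝 x, c < edist (f y) (f z) / edist y z := by
    have ht : Tendsto (fun z => edist (f y) (f z) / edist y z) (𝓝 x)
        (𝓝 (edist (f y) (f x) / edist y x)) := by
      refine ENNReal.Tendsto.div ((continuous_const.edist hf).tendsto x) (Or.inr ?_)
        ((continuous_const.edist continuous_id).tendsto x) (Or.inr ?_)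
      · exact edist_pos.2 hy1 |>.ne'
      · exact edist_ne_top _ _
    exact ht.eventually_const_lt hy3
  filter_upwards [h1, h2, h3] with z e1 e2 e3
  exact lt_of_lt_of_le e3 (le_iSup₂ (f := fun y (_ : y ∈ {y | y ≠ z ∧
    edist y z < ((n : ℝ≥0∞) + 1)⁻¹}) => edist (f y) (f z) / edist y z) y ⟨e1, e2⟩)

variable [MeasurableSpace M] [BorelSpace M]

/-- The domain of the Lipschitz energy: Lipschitz functions with `lip f ∈ L^p(m)`. -/
def lipDomain (m : Measure M) (p : ℝ≥0∞) : Submodule ℝ (M → ℝ) where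
  carrier := {f | (∃ K, LipschitzWith K f) ∧ MemLp (lip f) p m}
  zero_mem' := by
    refine ⟨⟨0, LipschitzWith.const 0⟩, ?_⟩
    have : lip (0 : M → ℝ) = 0 := by
      funext x
      have := lip_smul 0 (0 : M → ℝ) x
      simpa using this
    rw [this]; exact MemLp.zero
  add_mem' := by
    rintro f h ⟨hf1, hf⟩ ⟨hh1, hh⟩
    have hfh : ∃ K, LipschitzWith K (f + h) := by
      obtain ⟨K, hK⟩ := hf1
      obtain ⟨L, hL⟩ := hh1
      exact ⟨K + L, hK.add hL⟩
    have hc : Continuous (f + h) := hfh.choose_spec.continuous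
    refine ⟨hfh, (hf.add hh).mono (measurable_elip hc).ennreal_toReal.aestronglyMeasurable ?_⟩
    refine Eventually.of_forall fun x => ?_
    rw [Pi.add_apply, Real.norm_of_nonneg (lip_nonneg _ _),
      Real.norm_of_nonneg (add_nonneg (lip_nonneg _ _) (lip_nonneg _ _))]
    exact lip_add_le hf1 hh1 x
  smul_mem' := by
    rintro c f ⟨⟨K, hK⟩, hf⟩
    refine ⟨⟨_, (lipschitzWith_smul c).comp hK⟩, ?_⟩
    have : lip (c • f) = fun x => |c| * lip f x := funext (lip_smul c f)
    rw [this]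
    exact hf.const_mul |c|

/-- The functional `f ↦ lip f` on Lipschitz functions with `lip f ∈ L^p(m)`. -/
noncomputable def lipFunctional (m : Measure M) (p : ℝ≥0∞) [Fact (1 ≤ p)] :
    LpFunctional m p (lipDomain m p) where
  toL0 :=
    { toFun := fun f => AEEqFun.mk (f : M → ℝ)
        f.2.1.choose_spec.continuous.aestronglyMeasurable
      map_add' := fun _ _ => rfl
      map_smul' := fun _ _ => rfl }
  g f := MemLp.toLp (lip (f : M → ℝ)) f.2.2
  g_nonneg f := by
    rw [← Lp.coeFn_nonneg]
    filter_upwards [MemLp.coeFn_toLp f.2.2] with x hx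
    rw [hx]; exact lip_nonneg _ _
  g_add_le f h := by
    rw [← Lp.coeFn_le]
    filter_upwards [MemLp.coeFn_toLp f.2.2, MemLp.coeFn_toLp h.2.2, MemLp.coeFn_toLp (f + h).2.2,
      Lp.coeFn_add (MemLp.toLp _ f.2.2) (MemLp.toLp _ h.2.2)] with x h1 h2 h3 h4
    rw [h3, h4, Pi.add_apply, h1, h2]
    exact lip_add_le f.2.1 h.2.1 x
  g_smul c f := by
    refine Lp.ext ?_
    have h1 := MemLp.coeFn_toLp f.2.2
    have h2 := MemLp.coeFn_toLp (c • f).2.2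
    have h3 := Lp.coeFn_smul |c| (MemLp.toLp (lip (f : M → ℝ)) f.2.2)
    filter_upwards [h1, h2, h3] with x h1 h2 h3
    rw [h2, h3, Pi.smul_apply, h1, smul_eq_mul, ← lip_smul]
    rfl

/-- The measure is finite on bounded sets. -/
class IsFiniteOnBounded (m : Measure M) : Prop where
  lt_top : ∀ s : Set M, Bornology.IsBounded s → m s < ∞

instance (m : Measure M) [IsFiniteOnBounded m] : SigmaFinite m := by
  rcases isEmpty_or_nonempty M with h | ⟨⟨x⟩⟩
  · have : m = 0 := Measure.eq_zero_of_isEmpty m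
    rw [this]; infer_instance
  · refine ⟨⟨⟨fun n : ℕ => Metric.ball x n, fun _ => trivial,
      fun n => IsFiniteOnBounded.lt_top _ Metric.isBounded_ball, ?_⟩⟩⟩
    exact Metric.iUnion_ball_nat x

end Lip

/-! ### Normed modules, submodules and differentials -/

namespace LpFunctional

section Submodule
variable {M : Type*} [MeasurableSpace M] {m : Measure M} {p : ℝ≥0∞} [Fact (1 ≤ p)]
  {V : Type*} [AddCommGroup V] [Module ℝ V] (F : LpFunctional m p V)

/-- The characteristic function of a measurable set, as an element of `L^∞(m)`. -/
noncomputable def chi (m : Measure M) {A : Set M} (hA : MeasurableSet A) : Lp ℝ ∞ m :=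
  MemLp.toLp (A.indicator fun _ => (1 : ℝ)) ((memLp_top_const (1 : ℝ)).indicator hA)

/-- A linear subspace `N` of the `F`-module is a submodule: it is closed, stable under
`L^∞`-multiplication, and an `L^p(m)`-normed module with the inherited operations. -/
structure IsSubmodule (N : Submodule ℝ F.LpModule) : Prop where
  isClosed : IsClosed (N : Set F.LpModule)
  mul_mem : ∀ (a : Lp ℝ ∞ m), ∀ v ∈ N, F.linftyMul a v ∈ N
  add_mul : ∀ (a b : Lp ℝ ∞ m), ∀ v ∈ N,
    F.linftyMul (a + b) v = F.linftyMul a v + F.linftyMul b v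
  smul_mul : ∀ (c : ℝ) (a : Lp ℝ ∞ m), ∀ v ∈ N, F.linftyMul (c • a) v = c • F.linftyMul a v
  mul_add : ∀ (a : Lp ℝ ∞ m), ∀ v ∈ N, ∀ w ∈ N,
    F.linftyMul a (v + w) = F.linftyMul a v + F.linftyMul a w
  mul_smul : ∀ (c : ℝ) (a : Lp ℝ ∞ m), ∀ v ∈ N, F.linftyMul a (c • v) = c • F.linftyMul a v
  mul_mul : ∀ (a b : Lp ℝ ∞ m), ∀ v ∈ N,
    F.linftyMul (a • b : Lp ℝ ∞ m) v = F.linftyMul a (F.linftyMul b v)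
  one_mul : ∀ v ∈ N, F.linftyMul (chi m MeasurableSet.univ) v = v
  norm_eq : ∀ v ∈ N, ‖v‖ = ‖F.pointwiseNorm v‖
  pointwiseNorm_mul : ∀ (a : Lp ℝ ∞ m), ∀ v ∈ N,
    F.pointwiseNorm (F.linftyMul a v) = (|a| • F.pointwiseNorm v : Lp ℝ p m)
  locality : ∀ v ∈ N, ∀ (A : ℕ → Set M) (hA : ∀ n, MeasurableSet (A n)),
    (∀ n, F.linftyMul (chi m (hA n)) v = 0) →
      F.linftyMul (chi m (MeasurableSet.iUnion hA)) v = 0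
  glueing : ∀ (v : ℕ → F.LpModule) (A : ℕ → Set M) (hA : ∀ n, MeasurableSet (A n)),
    (∀ n, v n ∈ N) →
    (∀ i j, F.linftyMul (chi m ((hA i).inter (hA j))) (v i) =
      F.linftyMul (chi m ((hA i).inter (hA j))) (v j)) →
    limsup (fun n => ‖∑ i ∈ Finset.range n, F.linftyMul (chi m (hA i)) (v i)‖ₑ) atTop < ∞ →
    ∃ w ∈ N, (∀ i, F.linftyMul (chi m (hA i)) w = F.linftyMul (chi m (hA i)) (v i)) ∧
      ‖w‖ₑ ≤ liminf (fun n => ‖∑ i ∈ Finset.range n, F.linftyMul (chi m (hA i)) (v i)‖ₑ) atTop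

/-- The differential is closable as a partially defined operator from `L^0(m)` to the module. -/
def IsClosable : Prop :=
  ∀ (u : ℕ → V) (ω : F.LpModule), F.ConvergesTo u 0 →
    Tendsto (fun n => F.d (u n)) atTop (𝓝 ω) → ω = 0

/-- `i` embeds the module of `F` isometrically into the module of `F'`, compatibly with the
`L^∞`-module structure, the pointwise norms, and the differentials (along `j : V → V'`). -/
structure IsModuleEmbedding {V' : Type*} [AddCommGroup V'] [Module ℝ V']
    (F' : LpFunctional m p V') (j : V →ₗ[ℝ] V') (i : F.LpModule →ₗᵢ[ℝ] F'.LpModule) : Prop where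
  map_mul : ∀ (a : Lp ℝ ∞ m) (v : F.LpModule), i (F.linftyMul a v) = F'.linftyMul a (i v)
  map_pointwiseNorm : ∀ v : F.LpModule, F'.pointwiseNorm (i v) = F.pointwiseNorm v
  map_d : ∀ f : V, i (F.d f) = F'.d (j f)

end Submodule

end LpFunctional

section Modules
variable {M : Type*} [MetricSpace M] [MeasurableSpace M] [BorelSpace M]

/-- The lower relaxation of `f ↦ lip f`: the functional sending `f` to its relaxed slope. -/
noncomputable abbrev relaxedSlope (m : Measure M) [SigmaFinite m] (p : ℝ≥0∞) [Fact (1 ≤ p)]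
    (hp1 : 1 < p) (hp : p ≠ ∞) :
    LpFunctional m p ((lipFunctional m p).relaxDomain hp1 hp) :=
  (lipFunctional m p).relax hp1 hp

/-- The `L^p`-Lipschitz module. -/
abbrev LipschitzModule (m : Measure M) (p : ℝ≥0∞) [Fact (1 ≤ p)] : Type _ :=
  (lipFunctional m p).LpModule

/-- The `L^p`-cotangent module. -/
abbrev CotangentModule (m : Measure M) [SigmaFinite m] (p : ℝ≥0∞) [Fact (1 ≤ p)]
    (hp1 : 1 < p) (hp : p ≠ ∞) : Type _ :=
  (relaxedSlope m p hp1 hp).LpModule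

end Modules

/-!
Write `g f` for `lip f`. If `u n → f` in `L⁰` and `g (u n)` is bounded in `L^p`, choose convex
combinations `h n` of the tails of a subsequence of `u - f` converging to `0` a.e. which almost
minimize the norm of `g`. Averaging two of them shows, by uniform convexity of `L^p`, that `g` of
any further convex combinations converges to one limit `G`. This `G` is a strong upper relaxation
at `0`, hence `G = 0`, and `g (h n + f) → g f`. So bounds on `g (u n)` pass to `g f`: the energy is
lower semicontinuous, the differential is closable, and the relaxed slope of `f` is `g f`.

Consequently the generating families of the two modules have the same pointwise norm, and the
isometric embedding is obtained by completion. Pieces supported on disjoint sets have additive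
`p`-th powers of norms, so every element is the sum of its restrictions to a countable partition;
thus differentials generate the module, which gives uniqueness and surjectivity of the embedding,
and the same additivity makes the pieces of a gluing summable.
-/

section ConvexCombinations
variable {E : Type*} [AddCommGroup E] [Module ℝ E] {u h w : ℕ → E}

/-- `h n` is a finite convex combination of the tail `{u k | n ≤ k}`, for every `n`. Strong upper
relaxations are defined through such sequences. -/
def IsTailConvexCombination (h u : ℕ → E) : Prop :=
  ∀ n, h n ∈ convexHull ℝ (u '' Ici n)

namespace IsTailConvexCombination

theorem refl (u : ℕ → E) : IsTailConvexCombination u u :=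
  fun n => subset_convexHull ℝ _ ⟨n, self_mem_Ici, rfl⟩

theorem mem_of_antitone (hh : IsTailConvexCombination h u) {K : ℕ → Set E} (hK : Antitone K)
    (hKc : ∀ n, Convex ℝ (K n)) (hu : ∀ n, u n ∈ K n) (n : ℕ) : h n ∈ K n :=
  convexHull_min (by rintro _ ⟨k, hk, rfl⟩; exact hK hk (hu k)) (hKc n) (hh n)

theorem antitone_convexHull_tail (u : ℕ → E) : Antitone fun n => convexHull ℝ (u '' Ici n) :=
  fun _ _ hnk => convexHull_mono (image_mono (Ici_subset_Ici.2 hnk))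

theorem trans (hw : IsTailConvexCombination w h) (hh : IsTailConvexCombination h u) :
    IsTailConvexCombination w u :=
  hw.mem_of_antitone (antitone_convexHull_tail u) (fun _ => convex_convexHull ℝ _) hh

theorem of_comp {ns : ℕ → ℕ} (hh : IsTailConvexCombination h (u ∘ ns)) (hns : StrictMono ns) :
    IsTailConvexCombination h u := by
  refine fun n => convexHull_mono ?_ (hh n)
  rintro _ ⟨k, hk, rfl⟩
  exact ⟨ns k, (mem_Ici.1 hk).trans hns.le_apply, rfl⟩

theorem add_const {f : E} (hh : IsTailConvexCombination h fun n => u n - f) :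
    IsTailConvexCombination (fun n => h n + f) u := by
  refine hh.mem_of_antitone (K := fun n => (· + f) ⁻¹' convexHull ℝ (u '' Ici n))
    (fun _ _ hnk => preimage_mono (antitone_convexHull_tail u hnk))
    (fun n => (convex_convexHull ℝ _).translate_preimage_left f) fun n => ?_
  rw [mem_preimage, sub_add_cancel]
  exact refl u n

end IsTailConvexCombination

end ConvexCombinations

theorem exists_minimizing_seq {α : Type*} {T : ℕ → Set α} (hT : Antitone T) {φ : α → ℝ}
    (hφ : BddBelow (φ '' T 0)) {u : ℕ → α} (hu : ∀ n, u n ∈ T n) {C : ℝ}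
    (hC : ∀ n, φ (u n) ≤ C) :
    ∃ (b : ℕ → ℝ) (c : ℝ) (h : ℕ → α), Tendsto b atTop (𝓝 c) ∧ (∀ n, ∀ a ∈ T n, b n ≤ φ a) ∧
      (∀ n, h n ∈ T n) ∧ ∀ n : ℕ, φ (h n) ≤ c + 1 / ((n : ℝ) + 1) := by
  have hbdd (n : ℕ) : BddBelow (φ '' T n) := hφ.mono (image_mono (hT n.zero_le))
  have hne (n : ℕ) : (φ '' T n).Nonempty := ⟨_, mem_image_of_mem φ (hu n)⟩
  set b : ℕ → ℝ := fun n => sInf (φ '' T n)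
  have hbT (n : ℕ) : ∀ a ∈ T n, b n ≤ φ a := fun a ha => csInf_le (hbdd n) (mem_image_of_mem φ ha)
  have hmono : Monotone b := fun n k hnk => csInf_le_csInf (hbdd n) (hne k) (image_mono (hT hnk))
  have hbC : BddAbove (range b) := ⟨C, forall_mem_range.2 fun n => (hbT n _ (hu n)).trans (hC n)⟩
  have hnear (n : ℕ) : ∃ a ∈ T n, φ a < b n + 1 / ((n : ℝ) + 1) := by
    obtain ⟨_, ⟨a, ha, rfl⟩, hlt⟩ := exists_lt_of_csInf_lt (hne n)
      (lt_add_of_pos_right (b n) (Nat.one_div_pos_of_nat (n := n)))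
    exact ⟨a, ha, hlt⟩
  choose h hhT hlt using hnear
  exact ⟨b, ⨆ n, b n, h, tendsto_atTop_ciSup hmono hbC, hbT, hhT,
    fun n => (hlt n).le.trans (add_le_add_left (le_ciSup hbC n) _)⟩

section Lp
variable {M : Type*} [MeasurableSpace M] {m : Measure M} {p : ℝ≥0∞} [Fact (1 ≤ p)]

theorem Lp_tendsto_sub_of_midpoint {ι : Type*} {l : Filter ι} (hp1 : 1 < p) (hp : p ≠ ∞)
    {u v : ι → Lp ℝ p m} (hu : ∀ i, 0 ≤ u i) (hv : ∀ i, 0 ≤ v i) {b : ι → ℝ} {c : ℝ}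
    (huc : Tendsto (fun i => ‖u i‖) l (𝓝 c)) (hvc : Tendsto (fun i => ‖v i‖) l (𝓝 c))
    (hb : Tendsto b l (𝓝 c)) (hmid : ∀ i, b i ≤ ‖(2⁻¹ : ℝ) • (u i + v i)‖) :
    Tendsto (fun i => u i - v i) l (𝓝 0) := by
  have hr : 0 < p.toReal := ENNReal.toReal_pos (zero_lt_one.trans hp1).ne' hp
  set r := p.toReal
  have hmidc : Tendsto (fun i => ‖(2⁻¹ : ℝ) • (u i + v i)‖) l (𝓝 c) := by
    refine tendsto_of_tendsto_of_tendsto_of_le_of_le hb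
      (h := fun i => 2⁻¹ * (‖u i‖ + ‖v i‖)) ?_ hmid fun i => ?_
    · convert (huc.add hvc).const_mul 2⁻¹ using 2
      ring
    · rw [norm_smul, Real.norm_of_nonneg (by norm_num)]
      exact mul_le_mul_of_nonneg_left (norm_add_le _ _) (by norm_num)
  have hpow : Tendsto (fun i => ‖u i - v i‖ ^ r) l (𝓝 0) := by
    refine tendsto_order.2 ⟨fun a ha => .of_forall fun i => ha.trans_le (by positivity),
      fun δ hδ => ?_⟩
    obtain rfl | hl := l.eq_or_neBot
    · exact eventually_bot
    have hc : 0 ≤ c := ge_of_tendsto' huc fun i => norm_nonneg _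
    obtain ⟨C, -, hconv⟩ :=
      Lp_uniform_convexity (m := m) hp1 hp (ε := δ / (2 * c ^ r + 1)) (by positivity)
    have hsum := (huc.rpow_const (.inr hr.le)).add (hvc.rpow_const (.inr hr.le))
    have hrhs := (hsum.const_mul (δ / (2 * c ^ r + 1))).add
      (((hsum.div_const 2).sub (hmidc.rpow_const (.inr hr.le))).const_mul C)
    have hlt : δ / (2 * c ^ r + 1) * (c ^ r + c ^ r) + C * ((c ^ r + c ^ r) / 2 - c ^ r) < δ := by
      rw [add_self_div_two, sub_self, mul_zero, add_zero, ← two_mul, div_mul_eq_mul_div,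
        div_lt_iff₀ (by positivity)]
      linarith
    filter_upwards [hrhs.eventually_lt_const hlt] with i hi
    exact (hconv (u i) (v i) (hu i) (hv i)).trans_lt hi
  rw [tendsto_zero_iff_norm_tendsto_zero]
  simpa [← Real.rpow_mul (norm_nonneg _), hr.ne'] using
    hpow.rpow_const (p := r⁻¹) (.inr (by positivity))

end Lp

theorem TendstoL0.of_abs_sub_eq {M : Type*} [MeasurableSpace M] {m : Measure M}
    {f f' : ℕ → M →ₘ[m] ℝ} {g g' : M →ₘ[m] ℝ} (h : TendstoL0 m f g)
    (h' : ∀ n, |f' n - g'| = |f n - g|) : TendstoL0 m f' g' := by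
  intro E hE hE'
  have hcongr (n : ℕ) : ∀ᵐ x ∂m.restrict E, ‖f' n x - g' x‖ = ‖f n x - g x‖ := by
    refine ae_restrict_of_ae ?_
    have hfg := AEEqFun.coeFn_abs (f' n - g')
    rw [h' n] at hfg
    filter_upwards [hfg, AEEqFun.coeFn_abs (f n - g), AEEqFun.coeFn_sub (f n) g,
      AEEqFun.coeFn_sub (f' n) g'] with x h1 h2 h3 h4
    rw [h3, Pi.sub_apply] at h2
    rw [h4, Pi.sub_apply] at h1
    exact h1.symm.trans h2
  rw [tendstoInMeasure_iff_norm]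
  intro ε hε
  refine (tendstoInMeasure_iff_norm.1 (h E hE hE') ε hε).congr fun n =>
    measure_congr (eventuallyEq_set.2 ?_)
  filter_upwards [hcongr n] with x hx
  rw [hx]

namespace LpFunctional

section Closability
variable {M : Type*} [MeasurableSpace M] {m : Measure M} {p : ℝ≥0∞} [Fact (1 ≤ p)]
  {V : Type*} [AddCommGroup V] [Module ℝ V] (F : LpFunctional m p V)

theorem g_sub_comm (f h : V) : F.g (f - h) = F.g (h - f) := by
  simpa using F.g_smul (-1) (h - f)

theorem abs_g_sub_le (f h : V) : |F.g f - F.g h| ≤ F.g (f - h) := by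
  have hf := F.g_add_le (f - h) h
  have hh := F.g_add_le (h - f) f
  rw [sub_add_cancel] at hf hh
  rw [F.g_sub_comm h f] at hh
  exact abs_le'.2 ⟨sub_le_iff_le_add.2 hf, by rwa [neg_sub, sub_le_iff_le_add]⟩

theorem norm_g_sub_le (f h : V) : ‖F.g f - F.g h‖ ≤ ‖F.g (f - h)‖ := by
  refine norm_le_norm_of_abs_le_abs ?_
  rw [abs_of_nonneg (F.g_nonneg (f - h))]
  exact F.abs_g_sub_le f h

theorem g_convexComb_le {a b : ℝ} (ha : 0 ≤ a) (hb : 0 ≤ b) (v w : V) :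
    F.g (a • v + b • w) ≤ a • F.g v + b • F.g w := by
  simpa [F.g_smul, abs_of_nonneg, ha, hb] using F.g_add_le (a • v) (b • w)

theorem convexOn_norm_g : ConvexOn ℝ univ fun w => ‖F.g w‖ :=
  (Seminorm.of (𝕜 := ℝ) (fun w => ‖F.g w‖)
    (fun v w => (Lp_norm_mono (F.g_nonneg _) (F.g_add_le v w)).trans (norm_add_le _ _))
    fun a w => by rw [F.g_smul, norm_smul, Real.norm_eq_abs, abs_abs, Real.norm_eq_abs]).convexOn

theorem convex_norm_g_le (C : ℝ) : Convex ℝ {w : V | ‖F.g w‖ ≤ C} := by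
  simpa using F.convexOn_norm_g.convex_le C

theorem exists_g_le_of_mem_convexHull {s : Set V} {w : V} (hw : w ∈ convexHull ℝ s) :
    ∃ W ∈ convexHull ℝ (F.g '' s), F.g w ≤ W := by
  refine convexHull_min (t := {w | ∃ W ∈ convexHull ℝ (F.g '' s), F.g w ≤ W}) ?_ ?_ hw
  · exact fun v hv => ⟨_, subset_convexHull ℝ _ (mem_image_of_mem _ hv), le_rfl⟩
  · rintro v ⟨W₁, hW₁, h₁⟩ w ⟨W₂, hW₂, h₂⟩ a b ha hb hab
    exact ⟨a • W₁ + b • W₂, convex_convexHull ℝ _ hW₁ hW₂ ha hb hab,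
      (F.g_convexComb_le ha hb _ _).trans (add_le_add (Lp_smul_le ha h₁) (Lp_smul_le hb h₂))⟩

theorem tendsto_g_sub_of_minimizing (hp1 : 1 < p) (hp : p ≠ ∞) {T : ℕ → Set V}
    (hTc : ∀ n, Convex ℝ (T n)) {b : ℕ → ℝ} {c : ℝ} (hb : Tendsto b atTop (𝓝 c))
    (hbT : ∀ n, ∀ w ∈ T n, b n ≤ ‖F.g w‖) {ι : Type*} {l : Filter ι} {k : ι → ℕ}
    (hk : Tendsto k l atTop) {v w : ι → V} (hv : ∀ i, v i ∈ T (k i)) (hw : ∀ i, w i ∈ T (k i))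
    (hvc : Tendsto (fun i => ‖F.g (v i)‖) l (𝓝 c)) (hwc : Tendsto (fun i => ‖F.g (w i)‖) l (𝓝 c)) :
    Tendsto (fun i => F.g (v i) - F.g (w i)) l (𝓝 0) := by
  refine Lp_tendsto_sub_of_midpoint hp1 hp (fun _ => F.g_nonneg _) (fun _ => F.g_nonneg _) hvc hwc
    (hb.comp hk) fun i => ?_
  have hmem : (2⁻¹ : ℝ) • v i + (2⁻¹ : ℝ) • w i ∈ T (k i) :=
    hTc _ (hv i) (hw i) (by norm_num) (by norm_num) (by norm_num)
  refine (hbT _ _ hmem).trans (Lp_norm_mono (F.g_nonneg _) ?_)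
  rw [smul_add]
  exact F.g_convexComb_le (by norm_num) (by norm_num) _ _

theorem exists_stable_convexCombination (hp1 : 1 < p) (hp : p ≠ ∞) {u : ℕ → V} {C : ℝ}
    (hC : ∀ n, ‖F.g (u n)‖ ≤ C) :
    ∃ (h : ℕ → V) (G : Lp ℝ p m), IsTailConvexCombination h u ∧
      ∀ w, IsTailConvexCombination w h → Tendsto (fun n => F.g (w n)) atTop (𝓝 G) := by
  set T : ℕ → Set V := fun n => convexHull ℝ (u '' Ici n)
  have hTc (n : ℕ) : Convex ℝ (T n) := convex_convexHull ℝ _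
  have hT : Antitone T := IsTailConvexCombination.antitone_convexHull_tail u
  obtain ⟨b, c, h, hb, hbT, hhT, hhc⟩ := exists_minimizing_seq hT (φ := fun w => ‖F.g w‖)
    ⟨0, forall_mem_image.2 fun _ _ => norm_nonneg _⟩ (IsTailConvexCombination.refl u) hC
  have hlim {w : ℕ → V} (hw : IsTailConvexCombination w h) :
      Tendsto (fun n => ‖F.g (w n)‖) atTop (𝓝 c) := by
    refine tendsto_of_tendsto_of_tendsto_of_le_of_le hb
      (h := fun n : ℕ => c + 1 / ((n : ℝ) + 1)) ?_ (fun n => hbT n _ (hw.trans hhT n)) ?_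
    · simpa using (tendsto_one_div_add_atTop_nhds_zero_nat (𝕜 := ℝ)).const_add c
    · exact hw.mem_of_antitone (K := fun n : ℕ => {v | ‖F.g v‖ ≤ c + 1 / ((n : ℝ) + 1)})
        (fun _ _ hnk _ hv => le_trans hv (add_le_add_right (Nat.one_div_le_one_div hnk) c))
        (fun n => F.convex_norm_g_le _) hhc
  have hhlim := hlim (.refl h)
  have hcauchy : CauchySeq fun n => F.g (h n) := by
    rw [cauchySeq_iff_tendsto_dist_atTop_0]
    simp only [dist_eq_norm]
    rw [← tendsto_zero_iff_norm_tendsto_zero]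
    exact F.tendsto_g_sub_of_minimizing hp1 hp hTc hb hbT (k := fun i : ℕ × ℕ => min i.1 i.2)
      (tendsto_atTop_atTop.2 fun N => ⟨(N, N), fun i hi => le_min (Prod.le_def.1 hi).1
        (Prod.le_def.1 hi).2⟩)
      (fun i => hT (min_le_left _ _) (hhT i.1)) (fun i => hT (min_le_right _ _) (hhT i.2))
      (hhlim.comp (tendsto_fst.mono_left prod_atTop_atTop_eq.ge))
      (hhlim.comp (tendsto_snd.mono_left prod_atTop_atTop_eq.ge))
  obtain ⟨G, hG⟩ := cauchySeq_tendsto_of_complete hcauchy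
  refine ⟨h, G, hhT, fun w hw => ?_⟩
  simpa using (F.tendsto_g_sub_of_minimizing hp1 hp hTc hb hbT tendsto_id
    (hw.trans hhT) hhT (hlim hw) hhlim).add hG

theorem norm_dPfm (f : V) : ‖F.dPfm f‖ = ‖F.g f‖ := by
  change ‖MemLp.toLp _ _‖ = _
  rw [← Lp.toLp_coeFn (F.g f) (Lp.memLp _)]
  rfl

theorem dist_d (f h : V) : dist (F.d f) (F.d h) = ‖F.g (f - h)‖ := by
  rw [d, d, UniformSpace.Completion.dist_eq, dist_eq_norm, ← map_sub, norm_dPfm]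

variable [SigmaFinite m]

theorem exists_convexCombination_tendsto_g (hp1 : 1 < p) (hp : p ≠ ∞)
    (hstrong : ∀ G : Lp ℝ p m, F.IsStrongUpperRelaxation 0 G → G = 0)
    {u : ℕ → V} {f : V} (hu : F.ConvergesTo u (F.toL0 f)) {C : ℝ} (hC : ∀ n, ‖F.g (u n)‖ ≤ C) :
    ∃ v, IsTailConvexCombination v u ∧ Tendsto (fun n => F.g (v n)) atTop (𝓝 (F.g f)) := by
  have hu0 : F.ConvergesTo (fun n => u n - f) 0 := TendstoL0.of_abs_sub_eq hu fun n => by simp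
  obtain ⟨ns, hns, hae⟩ := hu0.exists_subseq_ae
  have hbdd (n : ℕ) : ‖F.g (u (ns n) - f)‖ ≤ C + ‖F.g f‖ := by
    have htri := F.norm_g_sub_le (u (ns n) - f) (-f)
    have hneg : F.g (-f) = F.g f := by simpa using F.g_sub_comm 0 f
    rw [sub_neg_eq_add, sub_add_cancel, hneg] at htri
    linarith [norm_sub_norm_le (F.g (u (ns n) - f)) (F.g f), hC (ns n)]
  obtain ⟨h, G, hh, hG⟩ := F.exists_stable_convexCombination hp1 hp hbdd
  have hlim := hG h (.refl h)
  have hh0 : F.ConvergesTo h 0 := tendstoL0_of_ae (F.ae_tendsto_of_convexHull hae hh)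
  have hG0 : G = 0 := hstrong G ⟨⟨h, G, hh0, weak_of_strong hlim, le_rfl⟩, h, hh0, hG⟩
  refine ⟨fun n => h n + f, .of_comp (.add_const hh) hns, ?_⟩
  rw [tendsto_iff_norm_sub_tendsto_zero]
  refine squeeze_zero (fun n => norm_nonneg _) (fun n => F.norm_g_sub_le _ _) ?_
  simpa [hG0] using hlim.norm

theorem norm_g_le_of_frequently (hp1 : 1 < p) (hp : p ≠ ∞)
    (hstrong : ∀ G : Lp ℝ p m, F.IsStrongUpperRelaxation 0 G → G = 0)
    {u : ℕ → V} {f : V} (hu : F.ConvergesTo u (F.toL0 f)) {C : ℝ}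
    (hC : ∃ᶠ n in atTop, ‖F.g (u n)‖ ≤ C) : ‖F.g f‖ ≤ C := by
  obtain ⟨ns, hns, hle⟩ := extraction_of_frequently_atTop hC
  obtain ⟨v, hv, hlim⟩ := F.exists_convexCombination_tendsto_g hp1 hp hstrong (hu.comp hns) hle
  exact le_of_tendsto' hlim.norm
    (hv.mem_of_antitone antitone_const (fun _ => F.convex_norm_g_le C) hle)

theorem lintegral_g_le_liminf (hp1 : 1 < p) (hp : p ≠ ∞)
    (hstrong : ∀ G : Lp ℝ p m, F.IsStrongUpperRelaxation 0 G → G = 0)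
    {u : ℕ → V} {f : V} (hu : F.ConvergesTo u (F.toL0 f)) :
    ∫⁻ x, ‖F.g f x‖ₑ ^ p.toReal ∂m ≤
      liminf (fun n => ∫⁻ x, ‖F.g (u n) x‖ₑ ^ p.toReal ∂m) atTop := by
  have hr : 0 < p.toReal := ENNReal.toReal_pos (zero_lt_one.trans hp1).ne' hp
  simp only [F.lintegral_g hp1 hp]
  refine le_of_forall_gt_imp_ge_of_dense fun c hc => ?_
  obtain rfl | hctop := eq_or_ne c ∞
  · exact le_top
  have hroot : c ^ p.toReal⁻¹ ≠ ∞ := ENNReal.rpow_ne_top_of_nonneg (by positivity) hctop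
  have hle {w : V} : ‖F.g w‖ₑ ^ p.toReal ≤ c ↔ ‖F.g w‖ ≤ (c ^ p.toReal⁻¹).toReal := by
    rw [← ENNReal.le_rpow_inv_iff hr, ← toReal_enorm,
      ENNReal.toReal_le_toReal enorm_ne_top hroot]
  exact hle.2 (F.norm_g_le_of_frequently hp1 hp hstrong hu
    ((frequently_lt_of_liminf_lt (by isBoundedDefault) hc).mono fun n hn => hle.1 hn.le))

theorem lowerRelax_toL0 (hp1 : 1 < p) (hp : p ≠ ∞)
    (hstrong : ∀ G : Lp ℝ p m, F.IsStrongUpperRelaxation 0 G → G = 0) (f : V) :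
    F.lowerRelax (F.toL0 f) = F.g f := by
  have hgreatest : IsGreatest (F.lowerSet (F.toL0 f)) (F.lowerRelax (F.toL0 f)) :=
    F.isGreatest_lowerRelax hp1 hp (F.toRelaxDomain hp1 hp f).2
  refine hgreatest.unique ⟨fun u G hu huG => ?_, fun G hG => ?_⟩
  · obtain ⟨C, hC⟩ := weak_bounded huG
    obtain ⟨v, hv, hlim⟩ := F.exists_convexCombination_tendsto_g hp1 hp hstrong hu hC
    choose W hW hle using fun n => F.exists_g_le_of_mem_convexHull (hv n)
    simp only [image_image] at hW
    exact weak_le (weak_of_strong hlim) (weak_convexHull huG hW) hle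
  · exact hG (fun _ => f) _ (tendstoL0_of_ae (by simp))
      (weak_of_strong tendsto_const_nhds)

theorem isClosable (hp1 : 1 < p) (hp : p ≠ ∞)
    (hstrong : ∀ G : Lp ℝ p m, F.IsStrongUpperRelaxation 0 G → G = 0) : F.IsClosable := by
  intro u ω hu hω
  refine tendsto_nhds_unique hω ?_
  have hd0 : F.d 0 = 0 := by rw [d, map_zero, UniformSpace.Completion.coe_zero]
  rw [← hd0, Metric.tendsto_atTop]
  intro ε hε
  obtain ⟨N, hN⟩ := Metric.cauchySeq_iff.1 hω.cauchySeq (ε / 2) (half_pos hε)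
  refine ⟨N, fun n hn => ?_⟩
  have hconv : F.ConvergesTo (fun k => u n - u k) (F.toL0 (u n)) :=
    TendstoL0.of_abs_sub_eq hu fun k => by simp
  rw [dist_d, sub_zero]
  refine (F.norm_g_le_of_frequently hp1 hp hstrong hconv ?_).trans_lt (half_lt_self hε)
  refine (eventually_atTop.2 ⟨N, fun k hk => ?_⟩).frequently
  rw [← dist_d]
  exact (hN n hn k hk).le

end Closability

section NormedModule
variable {M : Type*} [MeasurableSpace M] {m : Measure M} {p : ℝ≥0∞} [Fact (1 ≤ p)]
  {V : Type*} [AddCommGroup V] [Module ℝ V] (F : LpFunctional m p V)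

theorem continuous_pointwiseNorm : Continuous F.pointwiseNorm :=
  UniformSpace.Completion.continuous_extension

theorem norm_pointwiseNorm (v : F.LpModule) : ‖F.pointwiseNorm v‖ = ‖v‖ := by
  induction v using UniformSpace.Completion.induction_on with
  | hp => exact isClosed_eq F.continuous_pointwiseNorm.norm continuous_norm
  | ih s => rw [pointwiseNorm_coe, UniformSpace.Completion.norm_coe, Pfm.norm_def]

theorem pointwiseNorm_ae_eq_zero_iff {v : F.LpModule} : F.pointwiseNorm v =ᵐ[m] 0 ↔ v = 0 := by
  rw [← Lp.eq_zero_iff_ae_eq_zero, ← norm_eq_zero, norm_pointwiseNorm, norm_eq_zero]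

namespace Pfm
variable {F} {q : M → ℝ} (hq : IsCountablyValued q) {s t : F.Pfm}
  (ht : t.val = fun x => q x • s.val x)
include hq ht

theorem ae_pointwiseNorm_eq_of_val_eq_smul :
    ∀ᵐ x ∂m, t.pointwiseNorm x = |q x| * s.pointwiseNorm x := by
  filter_upwards [s.coeFn_pointwiseNorm, t.coeFn_pointwiseNorm, F.pointwise_smul hq s.2.1]
    with x hs htx hqs
  rw [hs, htx, ht]
  exact hqs

theorem norm_le_of_val_eq_smul {C : ℝ} (hC : ∀ᵐ x ∂m, |q x| ≤ C) : ‖t‖ ≤ C * ‖s‖ := by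
  rw [Pfm.norm_def, Pfm.norm_def]
  refine Lp.norm_le_mul_norm_of_ae_le_mul ?_
  filter_upwards [ae_pointwiseNorm_eq_of_val_eq_smul hq ht, hC] with x hx hqC
  rw [hx, norm_mul, Real.norm_eq_abs, abs_abs]
  exact mul_le_mul_of_nonneg_right hqC (norm_nonneg _)

end Pfm

/-- Multiplication by the countably valued approximation `approx a n` of `a`, as a continuous
linear map on the completion; `linftyMul a` is the pointwise limit of these maps. -/
noncomputable def approxMulL (a : Lp ℝ ∞ m) (n : ℕ) : F.LpModule →L[ℝ] F.LpModule :=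
  ((F.approxMul a n).mkContinuous (‖a‖ + 1) (F.norm_approxMul_le a n)).completion

/-- `linftyMul a` as a continuous linear map. -/
noncomputable def linftyMulL (a : Lp ℝ ∞ m) : F.LpModule →L[ℝ] F.LpModule :=
  continuousLinearMapOfTendsto (F.approxMulL a) (f := F.linftyMul a)
    (tendsto_pi_nhds.2 (F.tendsto_linftyMul a))

theorem continuous_linftyMul (a : Lp ℝ ∞ m) : Continuous (F.linftyMul a) :=
  (F.linftyMulL a).continuous

theorem linftyMul_add (a : Lp ℝ ∞ m) (v w : F.LpModule) :
    F.linftyMul a (v + w) = F.linftyMul a v + F.linftyMul a w :=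
  map_add (F.linftyMulL a) v w

theorem linftyMul_smul (c : ℝ) (a : Lp ℝ ∞ m) (v : F.LpModule) :
    F.linftyMul a (c • v) = c • F.linftyMul a v :=
  map_smul (F.linftyMulL a) c v

theorem linftyMul_sub (a : Lp ℝ ∞ m) (v w : F.LpModule) :
    F.linftyMul a (v - w) = F.linftyMul a v - F.linftyMul a w :=
  map_sub (F.linftyMulL a) v w

theorem linftyMul_sum {ι : Type*} (a : Lp ℝ ∞ m) (T : Finset ι) (v : ι → F.LpModule) :
    F.linftyMul a (∑ i ∈ T, v i) = ∑ i ∈ T, F.linftyMul a (v i) :=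
  map_sum (F.linftyMulL a) v T

theorem tendsto_approxMul_coe (a : Lp ℝ ∞ m) (s : F.Pfm) :
    Tendsto (fun n => (F.approxMul a n s : F.LpModule)) atTop (𝓝 (F.linftyMul a s)) := by
  simpa only [UniformSpace.Completion.map_coe (F.uniformContinuous_approxMul a _)] using
    F.tendsto_linftyMul a s

theorem isCountablyValued_approx_coeFn (a : Lp ℝ ∞ m) (n : ℕ) : IsCountablyValued (approx a n) :=
  isCountablyValued_approx (Lp.stronglyMeasurable a).measurable n

theorem norm_coe_sub_linftyMul_le (a : Lp ℝ ∞ m) {q : M → ℝ} (hq : IsCountablyValued q)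
    {s t : F.Pfm} (ht : t.val = fun x => q x • s.val x) {δ : ℝ}
    (hδ : ∀ᵐ x ∂m, |q x - a x| ≤ δ) : ‖(t : F.LpModule) - F.linftyMul a s‖ ≤ δ * ‖s‖ := by
  have hlim : Tendsto (fun n : ℕ => (δ + 1 / ((n : ℝ) + 1)) * ‖s‖) atTop (𝓝 (δ * ‖s‖)) := by
    simpa using (tendsto_one_div_add_atTop_nhds_zero_nat.const_add δ).mul_const ‖s‖
  refine le_of_tendsto_of_tendsto' ((F.tendsto_approxMul_coe a s).const_sub _).norm hlim
    fun n => ?_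
  rw [← UniformSpace.Completion.coe_sub, UniformSpace.Completion.norm_coe]
  refine Pfm.norm_le_of_val_eq_smul (q := fun x => q x - approx a n x)
    (hq.comp₂ (isCountablyValued_approx_coeFn a n) (· - ·)) ?_ ?_
  · funext x
    rw [sub_smul, ← congrFun ht x]
    rfl
  · filter_upwards [hδ] with x hx
    refine (abs_sub_le _ (a x) _).trans (add_le_add hx ?_)
    rw [abs_sub_comm]
    exact abs_approx_sub_le a n x

theorem tendsto_coe_linftyMul (a : Lp ℝ ∞ m) {q : ℕ → M → ℝ} (hq : ∀ n, IsCountablyValued (q n))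
    {s : F.Pfm} {t : ℕ → F.Pfm} (ht : ∀ n, (t n).val = fun x => q n x • s.val x) {C : ℝ}
    (hC : ∀ n : ℕ, ∀ᵐ x ∂m, |q n x - a x| ≤ C * (1 / ((n : ℝ) + 1))) :
    Tendsto (fun n => (t n : F.LpModule)) atTop (𝓝 (F.linftyMul a s)) := by
  rw [tendsto_iff_norm_sub_tendsto_zero]
  refine squeeze_zero (fun n => norm_nonneg _)
    (fun n => F.norm_coe_sub_linftyMul_le a (hq n) (ht n) (hC n)) ?_
  simpa using ((tendsto_one_div_add_atTop_nhds_zero_nat (𝕜 := ℝ)).const_mul C).mul_const ‖s‖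

theorem add_linftyMul (a b : Lp ℝ ∞ m) (v : F.LpModule) :
    F.linftyMul (a + b) v = F.linftyMul a v + F.linftyMul b v := by
  induction v using UniformSpace.Completion.induction_on with
  | hp =>
    exact isClosed_eq (F.continuous_linftyMul _)
      ((F.continuous_linftyMul a).add (F.continuous_linftyMul b))
  | ih s =>
    refine tendsto_nhds_unique (F.tendsto_coe_linftyMul (a + b)
      (q := fun n x => approx a n x + approx b n x)
      (t := fun n => F.approxMul a n s + F.approxMul b n s) (C := 2)
      (fun n => (isCountablyValued_approx_coeFn a n).comp₂
        (isCountablyValued_approx_coeFn b n) (· + ·)) (fun n => ?_) fun n => ?_)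
      (((F.tendsto_approxMul_coe a s).add (F.tendsto_approxMul_coe b s)).congr fun n =>
        (UniformSpace.Completion.coe_add _ _).symm)
    · exact funext fun x => (add_smul _ _ _).symm
    · filter_upwards [Lp.coeFn_add a b] with x hx
      rw [hx, Pi.add_apply, add_sub_add_comm, two_mul]
      exact (abs_add_le _ _).trans
        (add_le_add (abs_approx_sub_le a n x) (abs_approx_sub_le b n x))

theorem smul_linftyMul (c : ℝ) (a : Lp ℝ ∞ m) (v : F.LpModule) :
    F.linftyMul (c • a) v = c • F.linftyMul a v := by
  induction v using UniformSpace.Completion.induction_on with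
  | hp => exact isClosed_eq (F.continuous_linftyMul _) ((F.continuous_linftyMul a).const_smul c)
  | ih s =>
    refine tendsto_nhds_unique (F.tendsto_coe_linftyMul (c • a)
      (q := fun n x => c * approx a n x) (t := fun n => c • F.approxMul a n s) (C := |c|)
      (fun n => (isCountablyValued_const c).comp₂ (isCountablyValued_approx_coeFn a n) (· * ·))
      (fun n => funext fun x => (mul_smul _ _ _).symm) fun n => ?_)
      (((F.tendsto_approxMul_coe a s).const_smul c).congr fun n =>
        (UniformSpace.Completion.coe_smul _ _).symm)
    filter_upwards [Lp.coeFn_smul c a] with x hx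
    rw [hx, Pi.smul_apply, smul_eq_mul, ← mul_sub, abs_mul]
    exact mul_le_mul_of_nonneg_left (abs_approx_sub_le a n x) (abs_nonneg c)

theorem ae_abs_approx_mul_approx_sub_le (a b : Lp ℝ ∞ m) (n : ℕ) :
    ∀ᵐ x ∂m, |approx a n x * approx b n x - (a • b : Lp ℝ ∞ m) x| ≤
      (‖a‖ + 1 + ‖b‖) * (1 / ((n : ℝ) + 1)) := by
  filter_upwards [Lp.coeFn_lpSMul (r := ∞) a b, ae_abs_le a, ae_abs_le b] with x hab ha hb
  have ha_sub := abs_approx_sub_le a n x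
  have happrox : |approx a n x| ≤ ‖a‖ + 1 := by
    have hn : 1 / ((n : ℝ) + 1) ≤ 1 := (div_le_one (by positivity)).2 (by simp)
    linarith [abs_sub_abs_le_abs_sub (approx a n x) (a x)]
  calc |approx a n x * approx b n x - (a • b : Lp ℝ ∞ m) x|
      = |approx a n x * (approx b n x - b x) + b x * (approx a n x - a x)| := by
        rw [hab, Pi.smul_apply', smul_eq_mul]; ring_nf
    _ ≤ |approx a n x| * |approx b n x - b x| + |b x| * |approx a n x - a x| := by
        rw [← abs_mul, ← abs_mul]; exact abs_add_le _ _
    _ ≤ (‖a‖ + 1 + ‖b‖) * (1 / ((n : ℝ) + 1)) := by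
        rw [add_mul]
        gcongr
        exact abs_approx_sub_le b n x

theorem mul_linftyMul (a b : Lp ℝ ∞ m) (v : F.LpModule) :
    F.linftyMul (a • b : Lp ℝ ∞ m) v = F.linftyMul a (F.linftyMul b v) := by
  induction v using UniformSpace.Completion.induction_on with
  | hp =>
    exact isClosed_eq (F.continuous_linftyMul _)
      ((F.continuous_linftyMul a).comp (F.continuous_linftyMul b))
  | ih s =>
    have hlim : Tendsto (fun n => F.linftyMul a (F.approxMul b n s)) atTop
        (𝓝 (F.linftyMul a (F.linftyMul b s))) :=
      ((F.continuous_linftyMul a).tendsto _).comp (F.tendsto_approxMul_coe b s)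
    have hdiff : Tendsto (fun n => (F.approxMul a n (F.approxMul b n s) : F.LpModule) -
        F.linftyMul a (F.approxMul b n s)) atTop (𝓝 0) := by
      refine squeeze_zero_norm (a := fun n : ℕ => 1 / ((n : ℝ) + 1) * ((‖b‖ + 1) * ‖s‖))
        (fun n => ?_) (by simpa using
          (tendsto_one_div_add_atTop_nhds_zero_nat (𝕜 := ℝ)).mul_const ((‖b‖ + 1) * ‖s‖))
      refine (F.norm_coe_sub_linftyMul_le a (isCountablyValued_approx_coeFn a n) rfl
        (ae_of_all _ (abs_approx_sub_le a n))).trans ?_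
      gcongr
      exact F.norm_approxMul_le b n s
    refine tendsto_nhds_unique (F.tendsto_coe_linftyMul (a • b : Lp ℝ ∞ m)
      (q := fun n x => approx a n x * approx b n x)
      (t := fun n => F.approxMul a n (F.approxMul b n s))
      (fun n => (isCountablyValued_approx_coeFn a n).comp₂
        (isCountablyValued_approx_coeFn b n) (· * ·))
      (fun n => funext fun x => (mul_smul _ _ _).symm)
      (ae_abs_approx_mul_approx_sub_le a b)) ?_
    simpa only [sub_add_cancel, zero_add] using hdiff.add hlim

theorem sum_linftyMul {ι : Type*} (T : Finset ι) (a : ι → Lp ℝ ∞ m) (v : F.LpModule) :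
    F.linftyMul (∑ i ∈ T, a i) v = ∑ i ∈ T, F.linftyMul (a i) v :=
  map_sum (AddMonoidHom.mk' (F.linftyMul · v) (F.add_linftyMul · · v)) a T

theorem continuous_lpSMul (a : Lp ℝ ∞ m) : Continuous fun w : Lp ℝ p m => (a • w : Lp ℝ p m) :=
  AddMonoidHomClass.continuous_of_bound
    (AddMonoidHom.mk' (fun w : Lp ℝ p m => (a • w : Lp ℝ p m)) fun _ _ => Lp.add_smul _ _ _) ‖a‖
    fun _ => Lp.norm_smul_le _ _

theorem pointwiseNorm_linftyMul (a : Lp ℝ ∞ m) (v : F.LpModule) :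
    F.pointwiseNorm (F.linftyMul a v) = (|a| • F.pointwiseNorm v : Lp ℝ p m) := by
  induction v using UniformSpace.Completion.induction_on with
  | hp =>
    exact isClosed_eq (F.continuous_pointwiseNorm.comp (F.continuous_linftyMul a))
      ((continuous_lpSMul |a|).comp F.continuous_pointwiseNorm)
  | ih s =>
    refine tendsto_nhds_unique
      ((F.continuous_pointwiseNorm.tendsto _).comp (F.tendsto_approxMul_coe a s)) ?_
    rw [tendsto_iff_norm_sub_tendsto_zero]
    refine squeeze_zero (fun n => norm_nonneg _)
      (g := fun n : ℕ => 1 / ((n : ℝ) + 1) * ‖s.pointwiseNorm‖) (fun n => ?_)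
      (by simpa using
        (tendsto_one_div_add_atTop_nhds_zero_nat (𝕜 := ℝ)).mul_const ‖s.pointwiseNorm‖)
    rw [Function.comp_apply, pointwiseNorm_coe, pointwiseNorm_coe]
    refine Lp.norm_le_mul_norm_of_ae_le_mul ?_
    filter_upwards [Lp.coeFn_lpSMul (r := p) |a| s.pointwiseNorm, Lp.coeFn_abs a,
      Lp.coeFn_sub (F.approxMul a n s).pointwiseNorm (|a| • s.pointwiseNorm : Lp ℝ p m),
      Pfm.ae_pointwiseNorm_eq_of_val_eq_smul (isCountablyValued_approx_coeFn a n)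
        (t := F.approxMul a n s) rfl] with x hmul habs hsub happrox
    rw [hsub, Pi.sub_apply, hmul, happrox, Pi.smul_apply', habs, smul_eq_mul, ← sub_mul, norm_mul]
    exact mul_le_mul_of_nonneg_right
      ((abs_abs_sub_abs_le_abs_sub _ _).trans (abs_approx_sub_le a n x)) (norm_nonneg _)

theorem ae_pointwiseNorm_linftyMul (a : Lp ℝ ∞ m) (v : F.LpModule) :
    ∀ᵐ x ∂m, F.pointwiseNorm (F.linftyMul a v) x = |a x| * F.pointwiseNorm v x := by
  rw [pointwiseNorm_linftyMul]
  filter_upwards [Lp.coeFn_lpSMul (r := p) |a| (F.pointwiseNorm v), Lp.coeFn_abs a]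
    with x hmul habs
  rw [hmul, Pi.smul_apply', habs, smul_eq_mul]

theorem norm_linftyMul_mono {a b : Lp ℝ ∞ m} (hab : ∀ᵐ x ∂m, |a x| ≤ |b x|) (v : F.LpModule) :
    ‖F.linftyMul a v‖ ≤ ‖F.linftyMul b v‖ := by
  rw [← norm_pointwiseNorm, ← norm_pointwiseNorm]
  refine Lp.norm_le_norm_of_ae_le ?_
  filter_upwards [F.ae_pointwiseNorm_linftyMul a v, F.ae_pointwiseNorm_linftyMul b v, hab]
    with x ha hb hx
  simp only [ha, hb, Real.norm_eq_abs, abs_mul, abs_abs]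
  exact mul_le_mul_of_nonneg_right hx (abs_nonneg _)

end NormedModule

section Localization
variable {M : Type*} [MeasurableSpace M] {m : Measure M} {p : ℝ≥0∞} [Fact (1 ≤ p)]
  {V : Type*} [AddCommGroup V] [Module ℝ V] (F : LpFunctional m p V)

theorem coeFn_chi {A : Set M} (hA : MeasurableSet A) :
    chi m hA =ᵐ[m] A.indicator fun _ => (1 : ℝ) := MemLp.coeFn_toLp _

theorem chi_smul_chi {A B : Set M} (hA : MeasurableSet A) (hB : MeasurableSet B) :
    (chi m hA • chi m hB : Lp ℝ ∞ m) = chi m (hA.inter hB) := by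
  refine Lp.ext ?_
  filter_upwards [Lp.coeFn_lpSMul (r := ∞) (chi m hA) (chi m hB), coeFn_chi (m := m) hA,
    coeFn_chi (m := m) hB, coeFn_chi (m := m) (hA.inter hB)] with x hmul hAx hBx hABx
  rw [hmul, Pi.smul_apply', hAx, hBx, hABx, smul_eq_mul, ← inter_indicator_mul, mul_one]

theorem coeFn_sum_chi {ι : Type*} (T : Finset ι) {A : ι → Set M} (hA : ∀ i, MeasurableSet (A i)) :
    ∀ᵐ x ∂m, (∑ i ∈ T, chi m (hA i) : Lp ℝ ∞ m) x =
      ∑ i ∈ T, (A i).indicator (fun _ => (1 : ℝ)) x := by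
  have hchi : ∀ᵐ x ∂m, ∀ i ∈ T, chi m (hA i) x = (A i).indicator (fun _ => (1 : ℝ)) x :=
    (ae_ball_iff T.countable_toSet).2 fun i _ => coeFn_chi (hA i)
  filter_upwards [Lp.coeFn_finsetSum T fun i => chi m (hA i), hchi] with x hsum hx
  rw [hsum, Finset.sum_apply]
  exact Finset.sum_congr rfl hx

theorem sum_chi_of_pairwiseDisjoint {ι : Type*} {T : Finset ι} {A : ι → Set M}
    (hA : ∀ i, MeasurableSet (A i)) (hdisj : (T : Set ι).PairwiseDisjoint A) :
    ∑ i ∈ T, chi m (hA i) = chi m (T.measurableSet_biUnion fun i _ => hA i) := by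
  refine Lp.ext ?_
  filter_upwards [coeFn_sum_chi (m := m) T hA,
    coeFn_chi (m := m) (T.measurableSet_biUnion fun i _ => hA i)] with x hsum hunion
  rw [hsum, hunion, Finset.indicator_biUnion_apply T A hdisj]

theorem ae_abs_chi_biUnion_le_sum {ι : Type*} (T : Finset ι) {A D : ι → Set M}
    (hA : ∀ i, MeasurableSet (A i)) (hD : ∀ i, MeasurableSet (D i)) (hDA : ∀ i, D i ⊆ A i) :
    ∀ᵐ x ∂m, |chi m (T.measurableSet_biUnion fun i _ => hD i) x| ≤
      |(∑ i ∈ T, chi m (hA i) : Lp ℝ ∞ m) x| := by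
  filter_upwards [coeFn_sum_chi (m := m) T hA,
    coeFn_chi (m := m) (T.measurableSet_biUnion fun i _ => hD i)] with x hsum hunion
  have hnonneg : ∀ B : Set M, 0 ≤ B.indicator (fun _ => (1 : ℝ)) x :=
    fun B => indicator_nonneg (fun _ _ => zero_le_one) x
  rw [hsum, hunion, abs_of_nonneg (hnonneg _)]
  refine le_trans ?_ (le_abs_self _)
  refine indicator_apply_le' (fun hx => ?_) fun _ => Finset.sum_nonneg fun i _ => hnonneg _
  obtain ⟨i, hi, hxi⟩ := mem_iUnion₂.1 hx
  calc (1 : ℝ) = (A i).indicator (fun _ => (1 : ℝ)) x :=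
        (indicator_of_mem (hDA i hxi) fun _ => (1 : ℝ)).symm
    _ ≤ ∑ i ∈ T, (A i).indicator (fun _ => (1 : ℝ)) x :=
        Finset.single_le_sum (f := fun i => (A i).indicator (fun _ => (1 : ℝ)) x)
          (fun j _ => hnonneg _) hi

theorem linftyMul_chi_univ (v : F.LpModule) : F.linftyMul (chi m MeasurableSet.univ) v = v := by
  induction v using UniformSpace.Completion.induction_on with
  | hp => exact isClosed_eq (F.continuous_linftyMul _) continuous_id
  | ih s =>
    refine tendsto_nhds_unique (F.tendsto_coe_linftyMul (chi m MeasurableSet.univ)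
      (q := fun _ _ => 1) (t := fun _ => s) (C := 0) (fun _ => isCountablyValued_const 1)
      (fun _ => funext fun x => (one_smul _ _).symm) fun n => ?_) tendsto_const_nhds
    filter_upwards [coeFn_chi (m := m) MeasurableSet.univ] with x hx
    simp [hx]

theorem ae_pointwiseNorm_chi_mul {A : Set M} (hA : MeasurableSet A) (v : F.LpModule) :
    ∀ᵐ x ∂m, F.pointwiseNorm (F.linftyMul (chi m hA) v) x = A.indicator (F.pointwiseNorm v) x := by
  filter_upwards [F.ae_pointwiseNorm_linftyMul (chi m hA) v, coeFn_chi hA] with x hmul hx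
  rw [hmul, hx]
  by_cases hxA : x ∈ A <;> simp [hxA]

theorem chi_mul_eq_zero_iff {A : Set M} (hA : MeasurableSet A) {v : F.LpModule} :
    F.linftyMul (chi m hA) v = 0 ↔ ∀ᵐ x ∂m, x ∈ A → F.pointwiseNorm v x = 0 := by
  rw [← pointwiseNorm_ae_eq_zero_iff]
  refine eventually_congr ?_
  filter_upwards [F.ae_pointwiseNorm_chi_mul hA v] with x hx
  rw [hx, Pi.zero_apply, indicator_apply_eq_zero]

theorem chi_mul_iUnion_eq_zero {ι : Type*} [Countable ι] {v : F.LpModule} {A : ι → Set M}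
    (hA : ∀ i, MeasurableSet (A i)) (h : ∀ i, F.linftyMul (chi m (hA i)) v = 0) :
    F.linftyMul (chi m (MeasurableSet.iUnion hA)) v = 0 := by
  rw [chi_mul_eq_zero_iff]
  filter_upwards [ae_all_iff.2 fun i => (F.chi_mul_eq_zero_iff (hA i)).1 (h i)] with x hx hxA
  obtain ⟨i, hi⟩ := mem_iUnion.1 hxA
  exact hx i hi

theorem eq_of_chi_mul_eq {ι : Type*} [Countable ι] {v w : F.LpModule} {A : ι → Set M}
    (hA : ∀ i, MeasurableSet (A i)) (hU : ⋃ i, A i = univ)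
    (h : ∀ i, F.linftyMul (chi m (hA i)) v = F.linftyMul (chi m (hA i)) w) : v = w := by
  have hzero : F.linftyMul (chi m (MeasurableSet.iUnion hA)) (v - w) = 0 :=
    F.chi_mul_iUnion_eq_zero hA fun i => by rw [linftyMul_sub, h i, sub_self]
  simp only [hU] at hzero
  rwa [linftyMul_chi_univ, sub_eq_zero] at hzero

theorem chi_mul_chi_mul {A B : Set M} (hA : MeasurableSet A) (hB : MeasurableSet B)
    (v : F.LpModule) :
    F.linftyMul (chi m hA) (F.linftyMul (chi m hB) v) = F.linftyMul (chi m (hA.inter hB)) v := by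
  rw [← mul_linftyMul, chi_smul_chi]

theorem chi_mul_chi_mul_of_subset {A B : Set M} (hA : MeasurableSet A) (hB : MeasurableSet B)
    (hAB : A ⊆ B) (v : F.LpModule) :
    F.linftyMul (chi m hA) (F.linftyMul (chi m hB) v) = F.linftyMul (chi m hA) v := by
  simp only [chi_mul_chi_mul, inter_eq_left.2 hAB]

theorem chi_mul_chi_mul_of_superset {A B : Set M} (hA : MeasurableSet A) (hB : MeasurableSet B)
    (hBA : B ⊆ A) (v : F.LpModule) :
    F.linftyMul (chi m hA) (F.linftyMul (chi m hB) v) = F.linftyMul (chi m hB) v := by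
  simp only [chi_mul_chi_mul, inter_eq_right.2 hBA]

theorem chi_mul_chi_mul_of_disjoint {A B : Set M} (hA : MeasurableSet A) (hB : MeasurableSet B)
    (hAB : Disjoint A B) (v : F.LpModule) :
    F.linftyMul (chi m hA) (F.linftyMul (chi m hB) v) = 0 := by
  rw [chi_mul_eq_zero_iff]
  filter_upwards [F.ae_pointwiseNorm_chi_mul hB v] with x hx hxA
  rw [hx, indicator_of_notMem (hAB.notMem_of_mem_left hxA)]

theorem sum_chi_mul {ι : Type*} {T : Finset ι} {A : ι → Set M} (hA : ∀ i, MeasurableSet (A i))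
    (hdisj : (T : Set ι).PairwiseDisjoint A) (v : F.LpModule) :
    ∑ i ∈ T, F.linftyMul (chi m (hA i)) v =
      F.linftyMul (chi m (T.measurableSet_biUnion fun i _ => hA i)) v := by
  rw [← sum_linftyMul, sum_chi_of_pairwiseDisjoint hA hdisj]

theorem chi_mul_coe_eq_chi_mul_d (s : F.Pfm) (v : V) :
    F.linftyMul (chi m (s.2.1.2 v)) s = F.linftyMul (chi m (s.2.1.2 v)) (F.d v) := by
  rw [← sub_eq_zero, ← linftyMul_sub, chi_mul_eq_zero_iff, d, ← UniformSpace.Completion.coe_sub,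
    pointwiseNorm_coe]
  have hg : F.g 0 =ᵐ[m] 0 := by rw [F.g_zero]; exact Lp.coeFn_zero _ _ _
  filter_upwards [(s - F.dPfm v).coeFn_pointwiseNorm, hg] with x hx hg0 hxv
  have hval : (s - F.dPfm v).val x = 0 := sub_eq_zero.2 hxv
  rw [hx, pointwise, hval, hg0, Pi.zero_apply]

end Localization

section PartialGlue
variable {M : Type*} [MeasurableSpace M] {m : Measure M} {p : ℝ≥0∞} [Fact (1 ≤ p)]
  {V : Type*} [AddCommGroup V] [Module ℝ V] {F : LpFunctional m p V}

/-- The sum over `i < n` of `v i` restricted to the part of `A i` that no earlier set covers. -/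
noncomputable def partialGlue (v : ℕ → F.LpModule) {A : ℕ → Set M}
    (hA : ∀ n, MeasurableSet (A n)) (n : ℕ) : F.LpModule :=
  ∑ i ∈ Finset.range n, F.linftyMul (chi m (MeasurableSet.disjointed hA i)) (v i)

variable {v : ℕ → F.LpModule} {A : ℕ → Set M} (hA : ∀ n, MeasurableSet (A n))

theorem biUnion_disjointed_mul_partialGlue (n : ℕ) :
    F.linftyMul (chi m ((Finset.range n).measurableSet_biUnion fun i _ =>
      MeasurableSet.disjointed hA i)) (partialGlue v hA n) = partialGlue v hA n := by
  rw [partialGlue, linftyMul_sum]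
  exact Finset.sum_congr rfl fun i hi => chi_mul_chi_mul_of_superset _ _ _
    (subset_biUnion_of_mem (u := disjointed A) (Finset.mem_coe.2 hi)) _

variable (hcomp : ∀ i j, F.linftyMul (chi m ((hA i).inter (hA j))) (v i) =
  F.linftyMul (chi m ((hA i).inter (hA j))) (v j))
include hcomp

theorem chi_mul_partialGlue {i n : ℕ} (hi : i < n) :
    F.linftyMul (chi m (hA i)) (partialGlue v hA n) = F.linftyMul (chi m (hA i)) (v i) := by
  have hsub : A i ⊆ ⋃ j ∈ Finset.range n, disjointed A j := by
    obtain ⟨k, rfl⟩ := Nat.exists_eq_succ_of_ne_zero (Nat.ne_zero_of_lt hi)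
    rw [biUnion_range_succ_disjointed]
    exact le_partialSups_of_le A (Nat.lt_succ_iff.1 hi)
  have hterm : ∀ j, F.linftyMul (chi m (hA i))
      (F.linftyMul (chi m (MeasurableSet.disjointed hA j)) (v j)) =
      F.linftyMul (chi m (hA i)) (F.linftyMul (chi m (MeasurableSet.disjointed hA j)) (v i)) := by
    intro j
    have hD := MeasurableSet.disjointed hA j
    have hcompD := congrArg (F.linftyMul (chi m ((hA i).inter hD))) (hcomp i j)
    rw [chi_mul_chi_mul_of_subset _ _ _ (inter_subset_inter_right _ (disjointed_subset A j)),
      chi_mul_chi_mul_of_subset _ _ _ (inter_subset_inter_right _ (disjointed_subset A j))]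
      at hcompD
    rw [chi_mul_chi_mul, chi_mul_chi_mul, hcompD]
  rw [partialGlue, linftyMul_sum, Finset.sum_congr rfl fun j _ => hterm j, ← linftyMul_sum,
    sum_chi_mul F _ ((disjoint_disjointed A).set_pairwise _),
    chi_mul_chi_mul_of_subset _ _ _ hsub]

theorem norm_partialGlue_le (n : ℕ) :
    ‖partialGlue v hA n‖ ≤ ‖∑ i ∈ Finset.range n, F.linftyMul (chi m (hA i)) (v i)‖ := by
  have hsum : ∑ i ∈ Finset.range n, F.linftyMul (chi m (hA i)) (v i) =
      F.linftyMul (∑ i ∈ Finset.range n, chi m (hA i)) (partialGlue v hA n) := by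
    rw [sum_linftyMul]
    exact Finset.sum_congr rfl fun i hi =>
      (chi_mul_partialGlue hA hcomp (Finset.mem_range.1 hi)).symm
  calc ‖partialGlue v hA n‖
      = ‖F.linftyMul (chi m ((Finset.range n).measurableSet_biUnion fun i _ =>
          MeasurableSet.disjointed hA i)) (partialGlue v hA n)‖ := by
        rw [biUnion_disjointed_mul_partialGlue]
    _ ≤ ‖F.linftyMul (∑ i ∈ Finset.range n, chi m (hA i)) (partialGlue v hA n)‖ :=
        F.norm_linftyMul_mono
          (ae_abs_chi_biUnion_le_sum _ hA (MeasurableSet.disjointed hA) (disjointed_subset A)) _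
    _ = ‖∑ i ∈ Finset.range n, F.linftyMul (chi m (hA i)) (v i)‖ := by rw [hsum]

end PartialGlue

section Glueing
variable {M : Type*} [MeasurableSpace M] {m : Measure M} {p : ℝ≥0∞} [Fact (1 ≤ p)]
  {V : Type*} [AddCommGroup V] [Module ℝ V] {F : LpFunctional m p V} (hp : p ≠ ∞)
include hp

theorem enorm_rpow_eq_lintegral (v : F.LpModule) :
    ‖v‖ₑ ^ p.toReal = ∫⁻ x, ‖F.pointwiseNorm v x‖ₑ ^ p.toReal ∂m := by
  have hp0 : p ≠ 0 := (zero_lt_one.trans_le Fact.out).ne'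
  rw [← ofReal_norm, ← norm_pointwiseNorm, ofReal_norm, Lp.enorm_def,
    eLpNorm_eq_lintegral_rpow_enorm_toReal hp0 hp, ← ENNReal.rpow_mul,
    one_div_mul_cancel (ENNReal.toReal_pos hp0 hp).ne', ENNReal.rpow_one]

theorem enorm_chi_mul_rpow {A : Set M} (hA : MeasurableSet A) (v : F.LpModule) :
    ‖F.linftyMul (chi m hA) v‖ₑ ^ p.toReal =
      ∫⁻ x in A, ‖F.pointwiseNorm v x‖ₑ ^ p.toReal ∂m := by
  have hr : 0 < p.toReal := ENNReal.toReal_pos (zero_lt_one.trans_le Fact.out).ne' hp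
  rw [enorm_rpow_eq_lintegral hp, ← lintegral_indicator hA]
  refine lintegral_congr_ae ?_
  filter_upwards [F.ae_pointwiseNorm_chi_mul hA v] with x hx
  rw [hx]
  by_cases hxA : x ∈ A <;> simp [hxA, hr]

theorem norm_chi_mul_rpow_add_compl {A : Set M} (hA : MeasurableSet A) (v : F.LpModule) :
    ‖F.linftyMul (chi m hA) v‖ ^ p.toReal + ‖F.linftyMul (chi m hA.compl) v‖ ^ p.toReal =
      ‖v‖ ^ p.toReal := by
  have henorm : ‖F.linftyMul (chi m hA) v‖ₑ ^ p.toReal +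
      ‖F.linftyMul (chi m hA.compl) v‖ₑ ^ p.toReal = ‖v‖ₑ ^ p.toReal := by
    rw [enorm_chi_mul_rpow hp, enorm_chi_mul_rpow hp, lintegral_add_compl _ hA,
      enorm_rpow_eq_lintegral hp]
  have hfin : ∀ w : F.LpModule, ‖w‖ₑ ^ p.toReal ≠ ∞ := fun w =>
    ENNReal.rpow_ne_top_of_nonneg ENNReal.toReal_nonneg enorm_ne_top
  simpa only [ENNReal.toReal_add (hfin _) (hfin _), ← ENNReal.toReal_rpow, toReal_enorm] using
    congrArg ENNReal.toReal henorm

theorem norm_sum_chi_mul_rpow {ι : Type*} {A : ι → Set M} (hA : ∀ i, MeasurableSet (A i))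
    (hdisj : Pairwise (Function.onFun Disjoint A)) (v : ι → F.LpModule) (T : Finset ι) :
    ‖∑ i ∈ T, F.linftyMul (chi m (hA i)) (v i)‖ ^ p.toReal =
      ∑ i ∈ T, ‖F.linftyMul (chi m (hA i)) (v i)‖ ^ p.toReal := by
  classical
  have hr : 0 < p.toReal := ENNReal.toReal_pos (zero_lt_one.trans_le Fact.out).ne' hp
  induction T using Finset.induction_on with
  | empty => simp [Real.zero_rpow hr.ne']
  | insert j T hj ih =>
    have hne : ∀ i ∈ T, Disjoint (A j) (A i) := fun i hi => hdisj (ne_of_mem_of_not_mem hi hj).symm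
    rw [← norm_chi_mul_rpow_add_compl hp (hA j), linftyMul_sum, linftyMul_sum,
      Finset.sum_insert hj, Finset.sum_insert hj, Finset.sum_insert hj,
      chi_mul_chi_mul_of_subset _ _ _ subset_rfl,
      chi_mul_chi_mul_of_disjoint _ _ _ disjoint_compl_left,
      Finset.sum_eq_zero fun i hi => chi_mul_chi_mul_of_disjoint _ _ _ (hne i hi) _, add_zero,
      zero_add, Finset.sum_congr rfl fun i hi => chi_mul_chi_mul_of_superset _ _ _
        (hne i hi).subset_compl_left _, ih]

theorem summable_chi_mul {ι : Type*} {A : ι → Set M} (hA : ∀ i, MeasurableSet (A i))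
    (hdisj : Pairwise (Function.onFun Disjoint A)) {v : ι → F.LpModule}
    (hv : Summable fun i => ‖F.linftyMul (chi m (hA i)) (v i)‖ ^ p.toReal) :
    Summable fun i => F.linftyMul (chi m (hA i)) (v i) := by
  have hr : 0 < p.toReal := ENNReal.toReal_pos (zero_lt_one.trans_le Fact.out).ne' hp
  rw [summable_iff_vanishing_norm] at hv ⊢
  intro ε hε
  obtain ⟨S, hS⟩ := hv (ε ^ p.toReal) (by positivity)
  refine ⟨S, fun T hT => (Real.rpow_lt_rpow_iff (norm_nonneg _) hε.le hr).1 ?_⟩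
  rw [norm_sum_chi_mul_rpow hp hA hdisj]
  exact (le_abs_self _).trans_lt (hS T hT)

theorem hasSum_chi_mul {ι : Type*} [Countable ι] {A : ι → Set M} (hA : ∀ i, MeasurableSet (A i))
    (hdisj : Pairwise (Function.onFun Disjoint A)) (hU : ⋃ i, A i = univ) (v : F.LpModule) :
    HasSum (fun i => F.linftyMul (chi m (hA i)) v) v := by
  have hsum : Summable fun i => F.linftyMul (chi m (hA i)) v := by
    refine summable_chi_mul hp hA hdisj (summable_of_sum_le
      (c := ‖v‖ ^ p.toReal) (fun i => by positivity) fun T => ?_)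
    rw [← norm_sum_chi_mul_rpow hp hA hdisj, sum_chi_mul F hA (hdisj.set_pairwise _)]
    exact (le_add_of_nonneg_right (by positivity)).trans_eq (norm_chi_mul_rpow_add_compl hp _ v)
  have heq : ∑' i, F.linftyMul (chi m (hA i)) v = v := by
    refine F.eq_of_chi_mul_eq hA hU fun j => ?_
    have hj : F.linftyMul (chi m (hA j)) (∑' i, F.linftyMul (chi m (hA i)) v) =
        ∑' i, F.linftyMul (chi m (hA j)) (F.linftyMul (chi m (hA i)) v) :=
      (F.linftyMulL (chi m (hA j))).map_tsum hsum
    rw [hj, tsum_eq_single j fun i hi => chi_mul_chi_mul_of_disjoint _ _ _ (hdisj hi.symm) v,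
      chi_mul_chi_mul_of_subset _ _ _ subset_rfl]
  simpa only [heq] using hsum.hasSum

theorem eq_top_of_d_mem {N : Submodule ℝ F.LpModule} (hN : IsClosed (N : Set F.LpModule))
    (hmul : ∀ (A : Set M) (hA : MeasurableSet A), ∀ v ∈ N, F.linftyMul (chi m hA) v ∈ N)
    (hd : ∀ f, F.d f ∈ N) : N = ⊤ := by
  rw [Submodule.eq_top_iff']
  intro w
  induction w using UniformSpace.Completion.induction_on with
  | hp => exact hN
  | ih s =>
    have : Countable (range s.val) := s.2.1.1.to_subtype
    have hsum := hasSum_chi_mul (A := fun v : range s.val => s.val ⁻¹' {v.1}) hp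
      (fun v => s.2.1.2 v)
      (fun v w hvw => (disjoint_singleton.2 (Subtype.coe_ne_coe.2 hvw)).preimage _)
      (eq_univ_of_forall fun x => mem_iUnion.2 ⟨⟨s.val x, mem_range_self x⟩, rfl⟩) (s : F.LpModule)
    refine hN.mem_of_tendsto hsum (Eventually.of_forall fun T => N.sum_mem fun v _ => ?_)
    exact (F.chi_mul_coe_eq_chi_mul_d s v).symm ▸ hmul _ _ _ (hd v)

theorem exists_tendsto_partialGlue {v : ℕ → F.LpModule} {A : ℕ → Set M}
    (hA : ∀ n, MeasurableSet (A n)) {C : ℝ} (hC : ∃ᶠ n in atTop, ‖partialGlue v hA n‖ ≤ C) :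
    ∃ w, Tendsto (partialGlue v hA) atTop (𝓝 w) := by
  have hD := MeasurableSet.disjointed hA
  have hbound : ∀ n, ∑ i ∈ Finset.range n, ‖F.linftyMul (chi m (hD i)) (v i)‖ ^ p.toReal ≤
      C ^ p.toReal := by
    intro n
    obtain ⟨k, hnk, hk⟩ := frequently_atTop.1 hC n
    calc ∑ i ∈ Finset.range n, ‖F.linftyMul (chi m (hD i)) (v i)‖ ^ p.toReal
        ≤ ∑ i ∈ Finset.range k, ‖F.linftyMul (chi m (hD i)) (v i)‖ ^ p.toReal :=
          Finset.sum_le_sum_of_subset_of_nonneg (Finset.range_mono hnk) fun _ _ _ => by positivity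
      _ = ‖partialGlue v hA k‖ ^ p.toReal :=
          (norm_sum_chi_mul_rpow hp hD (disjoint_disjointed A) v _).symm
      _ ≤ C ^ p.toReal := Real.rpow_le_rpow (norm_nonneg _) hk ENNReal.toReal_nonneg
  have hsum := summable_chi_mul hp hD (disjoint_disjointed A)
    (summable_of_sum_range_le (fun n => by positivity) hbound)
  exact ⟨_, hsum.hasSum.tendsto_sum_nat⟩

theorem exists_glue {N : Submodule ℝ F.LpModule} (hN : IsClosed (N : Set F.LpModule))
    (hmul : ∀ (A : Set M) (hA : MeasurableSet A), ∀ v ∈ N, F.linftyMul (chi m hA) v ∈ N)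
    {v : ℕ → F.LpModule} {A : ℕ → Set M} (hA : ∀ n, MeasurableSet (A n)) (hv : ∀ n, v n ∈ N)
    (hcomp : ∀ i j, F.linftyMul (chi m ((hA i).inter (hA j))) (v i) =
      F.linftyMul (chi m ((hA i).inter (hA j))) (v j))
    (hlim : limsup (fun n => ‖∑ i ∈ Finset.range n, F.linftyMul (chi m (hA i)) (v i)‖ₑ)
      atTop < ∞) :
    ∃ w ∈ N, (∀ i, F.linftyMul (chi m (hA i)) w = F.linftyMul (chi m (hA i)) (v i)) ∧
      ‖w‖ₑ ≤
        liminf (fun n => ‖∑ i ∈ Finset.range n, F.linftyMul (chi m (hA i)) (v i)‖ₑ) atTop := by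
  have hle : ∀ n, ‖partialGlue v hA n‖ₑ ≤
      ‖∑ i ∈ Finset.range n, F.linftyMul (chi m (hA i)) (v i)‖ₑ :=
    fun n => enorm_le_iff_norm_le.2 (norm_partialGlue_le hA hcomp n)
  obtain ⟨w, hw⟩ : ∃ w, Tendsto (partialGlue v hA) atTop (𝓝 w) := by
    obtain ⟨c, hlimc, hc⟩ := exists_between hlim
    refine exists_tendsto_partialGlue hp hA (C := c.toReal)
      ((eventually_lt_of_limsup_lt hlimc).mono fun n hn => ?_).frequently
    rw [← toReal_enorm]
    exact ENNReal.toReal_mono hc.ne ((hle n).trans hn.le)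
  refine ⟨w, hN.mem_of_tendsto hw (Eventually.of_forall fun n => N.sum_mem fun i _ =>
    hmul _ _ _ (hv i)), fun i => ?_, ?_⟩
  · refine tendsto_nhds_unique (((F.continuous_linftyMul _).tendsto w).comp hw)
      (tendsto_const_nhds.congr' ((eventually_gt_atTop i).mono fun n hn => ?_))
    exact (chi_mul_partialGlue hA hcomp hn).symm
  · rw [← hw.enorm.liminf_eq]
    exact liminf_le_liminf (Eventually.of_forall hle)

theorem isSubmodule_of_isClosed {N : Submodule ℝ F.LpModule}
    (hN : IsClosed (N : Set F.LpModule))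
    (hmul : ∀ (a : Lp ℝ ∞ m), ∀ v ∈ N, F.linftyMul a v ∈ N) : F.IsSubmodule N where
  isClosed := hN
  mul_mem := hmul
  add_mul a b v _ := F.add_linftyMul a b v
  smul_mul c a v _ := F.smul_linftyMul c a v
  mul_add a v _ w _ := F.linftyMul_add a v w
  mul_smul c a v _ := F.linftyMul_smul c a v
  mul_mul a b v _ := F.mul_linftyMul a b v
  one_mul v _ := F.linftyMul_chi_univ v
  norm_eq v _ := (F.norm_pointwiseNorm v).symm
  pointwiseNorm_mul a v _ := F.pointwiseNorm_linftyMul a v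
  locality _ _ _ hA h := F.chi_mul_iUnion_eq_zero hA h
  glueing _ _ hA hv hcomp hlim :=
    exists_glue hp hN (fun _ hB => hmul (chi m hB)) hA hv hcomp hlim

end Glueing

section Embedding
variable {M : Type*} [MeasurableSpace M] {m : Measure M} {p : ℝ≥0∞} [Fact (1 ≤ p)]
  {V : Type*} [AddCommGroup V] [Module ℝ V] {V' : Type*} [AddCommGroup V'] [Module ℝ V']

theorem IsCountablyValued.map {W W' : Type*} {s : M → W} (hs : IsCountablyValued s) (φ : W → W') :
    IsCountablyValued fun x => φ (s x) :=
  hs.comp₂ (isCountablyValued_const ()) fun w _ => φ w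

variable {F : LpFunctional m p V} {F' : LpFunctional m p V'}

theorem pointwise_map {j : V → V'} (hj : ∀ f, F'.g (j f) = F.g f) (s : M → V) :
    F'.pointwise (fun x => j (s x)) = F.pointwise s :=
  funext fun x => by rw [pointwise, pointwise, hj]

/-- The map `(f_i, A_i)_i ↦ (j f_i, A_i)_i` of generating families induced by a linear map `j`
preserving the functionals. -/
noncomputable def mapPfm (j : V →ₗ[ℝ] V') (hj : ∀ f, F'.g (j f) = F.g f) : F.Pfm →ₗ[ℝ] F'.Pfm where
  toFun s := ⟨fun x => j (s.val x), s.2.1.map j, by rw [pointwise_map hj]; exact s.2.2⟩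
  map_add' s t := Subtype.ext <| funext fun x => map_add j (s.val x) (t.val x)
  map_smul' c s := Subtype.ext <| funext fun x => map_smul j c (s.val x)

variable {j : V →ₗ[ℝ] V'} (hj : ∀ f, F'.g (j f) = F.g f)

theorem pointwiseNorm_mapPfm (s : F.Pfm) : (mapPfm j hj s).pointwiseNorm = s.pointwiseNorm := by
  refine Lp.ext ?_
  filter_upwards [(mapPfm j hj s).coeFn_pointwiseNorm, s.coeFn_pointwiseNorm] with x hmap hs
  rw [hmap, hs]
  exact congrFun (pointwise_map hj s.val) x

theorem norm_mapPfm (s : F.Pfm) : ‖mapPfm j hj s‖ = ‖s‖ := by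
  rw [Pfm.norm_def, Pfm.norm_def, pointwiseNorm_mapPfm]

/-- The map of modules extending `mapPfm` to the completions. -/
noncomputable def mapL (j : V →ₗ[ℝ] V') (hj : ∀ f, F'.g (j f) = F.g f) :
    F.LpModule →L[ℝ] F'.LpModule :=
  ((mapPfm j hj).mkContinuous 1 fun s => by rw [norm_mapPfm, one_mul]).completion

theorem mapL_coe (s : F.Pfm) : mapL j hj (s : F.LpModule) = (mapPfm j hj s : F'.Pfm) :=
  ContinuousLinearMap.completion_apply_coe _ s

theorem mapL_d (f : V) : mapL j hj (F.d f) = F'.d (j f) :=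
  mapL_coe hj (F.dPfm f)

theorem pointwiseNorm_mapL (v : F.LpModule) :
    F'.pointwiseNorm (mapL j hj v) = F.pointwiseNorm v := by
  induction v using UniformSpace.Completion.induction_on with
  | hp =>
    exact isClosed_eq (F'.continuous_pointwiseNorm.comp (mapL j hj).continuous)
      F.continuous_pointwiseNorm
  | ih s => rw [mapL_coe, pointwiseNorm_coe, pointwiseNorm_coe, pointwiseNorm_mapPfm]

theorem mapL_linftyMul (a : Lp ℝ ∞ m) (v : F.LpModule) :
    mapL j hj (F.linftyMul a v) = F'.linftyMul a (mapL j hj v) := by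
  induction v using UniformSpace.Completion.induction_on with
  | hp =>
    exact isClosed_eq ((mapL j hj).continuous.comp (F.continuous_linftyMul a))
      ((F'.continuous_linftyMul a).comp (mapL j hj).continuous)
  | ih s =>
    have map_approxMul (n : ℕ) : mapPfm j hj (F.approxMul a n s) =
        F'.approxMul a n (mapPfm j hj s) :=
      Subtype.ext <| funext fun x => map_smul j _ _
    rw [mapL_coe]
    refine tendsto_nhds_unique
      (((mapL j hj).continuous.tendsto _).comp (F.tendsto_approxMul_coe a s))
      ((F'.tendsto_approxMul_coe a (mapPfm j hj s)).congr fun n => ?_)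
    rw [Function.comp_apply, mapL_coe, map_approxMul]

include hj in
theorem exists_isModuleEmbedding :
    ∃ i : F.LpModule →ₗᵢ[ℝ] F'.LpModule, F.IsModuleEmbedding F' j i :=
  ⟨{ (mapL j hj).toLinearMap with
      norm_map' := fun v => by
        rw [← norm_pointwiseNorm, ← norm_pointwiseNorm]
        exact congrArg norm (pointwiseNorm_mapL hj v) },
    mapL_linftyMul hj, pointwiseNorm_mapL hj, mapL_d hj⟩

namespace IsModuleEmbedding
variable {i : F.LpModule →ₗᵢ[ℝ] F'.LpModule} (hi : F.IsModuleEmbedding F' j i)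
include hi

theorem unique (hp : p ≠ ∞) {i' : F.LpModule →ₗᵢ[ℝ] F'.LpModule}
    (hi' : F.IsModuleEmbedding F' j i') : i' = i := by
  have h : LinearMap.eqLocus i'.toLinearMap i.toLinearMap = ⊤ := by
    refine eq_top_of_d_mem hp (isClosed_eq i'.continuous i.continuous) (fun A hA v hv => ?_)
      fun f => (hi'.map_d f).trans (hi.map_d f).symm
    have hv : i' v = i v := hv
    exact (hi'.map_mul _ v).trans ((congrArg _ hv).trans (hi.map_mul _ v).symm)
  exact LinearIsometry.ext fun v => h.ge (Submodule.mem_top (x := v))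

theorem linftyMul_mem_range (a : Lp ℝ ∞ m) :
    ∀ v ∈ LinearMap.range i.toLinearMap, F'.linftyMul a v ∈ LinearMap.range i.toLinearMap := by
  rintro _ ⟨v, rfl⟩
  exact ⟨F.linftyMul a v, hi.map_mul a v⟩

theorem range_eq_top (hp : p ≠ ∞) (hd : ∀ f, F'.d f ∈ closure (range fun h => F'.d (j h))) :
    LinearMap.range i.toLinearMap = ⊤ := by
  have hclosed : IsClosed (LinearMap.range i.toLinearMap : Set F'.LpModule) :=
    i.isometry.isClosedEmbedding.isClosed_range
  refine eq_top_of_d_mem hp hclosed (fun _ _ => hi.linftyMul_mem_range _) fun f =>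
    closure_minimal ?_ hclosed (hd f)
  rintro _ ⟨h, rfl⟩
  exact ⟨F.d h, hi.map_d h⟩

end IsModuleEmbedding

end Embedding

end LpFunctional

theorem lintegral_elip_rpow {M : Type*} [MetricSpace M] [MeasurableSpace M] [BorelSpace M]
    {m : Measure M} {p : ℝ≥0∞} [Fact (1 ≤ p)] (f : lipDomain m p) :
    ∫⁻ x, elip (f : M → ℝ) x ^ p.toReal ∂m =
      ∫⁻ x, ‖(lipFunctional m p).g f x‖ₑ ^ p.toReal ∂m := by
  refine lintegral_congr_ae ?_
  filter_upwards [MemLp.coeFn_toLp f.2.2] with x hx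
  have hg : (lipFunctional m p).g f x = lip (f : M → ℝ) x := hx
  rw [hg, Real.enorm_of_nonneg (lip_nonneg _ _), lip, ENNReal.ofReal_toReal (elip_ne_top f.2.1 x)]

theorem mainTheorem9_general {M : Type*} [MeasurableSpace M] {m : Measure M} [SigmaFinite m]
    {p : ℝ≥0∞} [Fact (1 ≤ p)] {V : Type*} [AddCommGroup V] [Module ℝ V] (F : LpFunctional m p V)
    (hp1 : 1 < p) (hp : p ≠ ∞)
    (hstrong : ∀ G : Lp ℝ p m, F.IsStrongUpperRelaxation 0 G → G = 0) :
    (∀ (u : ℕ → V) (f : V), F.ConvergesTo u (F.toL0 f) →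
      ∫⁻ x, ‖F.g f x‖ₑ ^ p.toReal ∂m ≤
        liminf (fun n => ∫⁻ x, ‖F.g (u n) x‖ₑ ^ p.toReal ∂m) atTop) ∧
    F.IsClosable ∧
    ∃ i : F.LpModule →ₗᵢ[ℝ] (F.relax hp1 hp).LpModule,
      F.IsModuleEmbedding (F.relax hp1 hp) (F.toRelaxDomain hp1 hp) i ∧
      (∀ i' : F.LpModule →ₗᵢ[ℝ] (F.relax hp1 hp).LpModule,
        F.IsModuleEmbedding (F.relax hp1 hp) (F.toRelaxDomain hp1 hp) i' → i' = i) ∧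
      (F.relax hp1 hp).IsSubmodule (LinearMap.range i.toLinearMap) ∧
      ((∀ f : F.relaxDomain hp1 hp, (F.relax hp1 hp).d f ∈
        closure (range fun h : V => (F.relax hp1 hp).d (F.toRelaxDomain hp1 hp h))) →
        LinearMap.range i.toLinearMap = ⊤) := by
  refine ⟨fun u f hu => F.lintegral_g_le_liminf hp1 hp hstrong hu, F.isClosable hp1 hp hstrong, ?_⟩
  obtain ⟨i, hi⟩ := LpFunctional.exists_isModuleEmbedding (F' := F.relax hp1 hp)
    (j := F.toRelaxDomain hp1 hp) fun f => F.lowerRelax_toL0 hp1 hp hstrong f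
  exact ⟨i, hi, fun i' hi' => hi.unique hp hi',
    LpFunctional.isSubmodule_of_isClosed hp i.isometry.isClosedEmbedding.isClosed_range
      hi.linftyMul_mem_range,
    hi.range_eq_top hp⟩

theorem mainTheorem9 {M : Type*} [MetricSpace M] [CompleteSpace M] [MeasurableSpace M]
    [BorelSpace M] (m : Measure M) [m.Regular] [IsFiniteOnBounded m]
    (p : ℝ≥0∞) [Fact (1 ≤ p)] (hp1 : 1 < p) (hp : p ≠ ∞)
    (hstrong : ∀ G : Lp ℝ p m, (lipFunctional m p).IsStrongUpperRelaxation 0 G → G = 0) :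
    -- lower semicontinuity of the Lipschitz energy on its domain, with respect to `L^0(m)`
    (∀ (u : ℕ → lipDomain m p) (f : lipDomain m p),
      (lipFunctional m p).ConvergesTo u ((lipFunctional m p).toL0 f) →
        ∫⁻ x, elip (f : M → ℝ) x ^ p.toReal ∂m ≤
          liminf (fun n => ∫⁻ x, elip (u n : M → ℝ) x ^ p.toReal ∂m) atTop) ∧
    -- the Lipschitz differential is closable
    (lipFunctional m p).IsClosable ∧
    -- the Lipschitz module is a submodule of the cotangent module
    ∃ i : LipschitzModule m p →ₗᵢ[ℝ] CotangentModule m p hp1 hp,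
      (lipFunctional m p).IsModuleEmbedding (relaxedSlope m p hp1 hp)
        ((lipFunctional m p).toRelaxDomain hp1 hp) i ∧
      (∀ i' : LipschitzModule m p →ₗᵢ[ℝ] CotangentModule m p hp1 hp,
        (lipFunctional m p).IsModuleEmbedding (relaxedSlope m p hp1 hp)
          ((lipFunctional m p).toRelaxDomain hp1 hp) i' → i' = i) ∧
      (relaxedSlope m p hp1 hp).IsSubmodule (LinearMap.range i.toLinearMap) ∧
      -- if differentials of Lipschitz functions are dense among Sobolev differentials,
      -- then the two modules agree
      ((∀ f : (lipFunctional m p).relaxDomain hp1 hp,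
        (relaxedSlope m p hp1 hp).d f ∈ closure (range fun h : lipDomain m p =>
          (relaxedSlope m p hp1 hp).d ((lipFunctional m p).toRelaxDomain hp1 hp h))) →
        LinearMap.range i.toLinearMap = ⊤) := by
  simpa only [lintegral_elip_rpow] using mainTheorem9_general (lipFunctional m p) hp1 hp hstrong
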